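/- Let $m\ge 1$ be an integer, let $\mathbb K\in\{\mathbb R,\mathbb C\}$, and let $\mathcal S_m$ be the metric star graph obtained from $m$ disjoint half-lines $[0,\infty)$ by identifying their origins to one point $0$. Write $x_i$ for the point on the $i$-th ray at distance $|x_i|=x\ge 0$ from $0$, $f_i(x)=f(x_i)$ for the components of a function $f$ on $\mathcal S_m$, and $C_b(\cdot)$ for the bounded continuous $\mathbb K$-valued functions. Consider the harmonic oscillator $$Bf(x_i)=\tfrac12\bigl(f''(x_i)-|x_i|^2f(x_i)+f(x_i)\bigr),$$ $$D(B)=\Bigl\{f\in C_b(\mathcal S_m):\ f_i\in\bigcap_{1\le p<\infty}W^{2,p}_{\rm loc}([0,\infty))\ (1\le i\le m),\ \ \sum_{i=1}^m f_i'(0)=0,\ \ Bf\in C_b(\mathcal S_m)\Bigr\},$$ where $f_i'(0)$ is the derivative at $0$ from the right. Given $f\in C_b(\mathcal S_m)$, a classical solution of $$(\mathrm P_B)\qquad \partial_tu(t,\cdot)=Bu(t,\cdot)\ \ (t>0),\qquad u(0,\cdot)=f,$$ is a function $u\in C_b([0,\infty)\times\mathcal S_m)$ such that $u(\cdot,x)\in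 C^1((0,\infty))$ for every $x\in\mathcal S_m$, $u(t,\cdot)\in D(B)$ for every $t>0$, and $u$ satisfies $(\mathrm P_B)$ at every point of $\mathcal S_m$. There is a semigroup $(U_m(t))_{t\ge0}$ of bounded linear operators on $C_b(\mathcal S_m)$ (that is, $U_m(0)=I$ and $U_m(s+t)=U_m(s)U_m(t)$ for $s,t\ge 0$), given for $t>0$, $f\in C_b(\mathcal S_m)$, $1\le i\le m$ and $x\ge 0$ by $$\begin{aligned}(U_m(t)f)(x_i)={}&\frac{2}{\sqrt{\pi(1-e^{-2t})}}\int_0^\infty \exp\Bigl[-\frac{(1+e^{-2t})(x^2+y^2)}{2(1-e^{-2t})}\Bigr]\sinh\Bigl(\frac{2xy\,e^{-t}}{1-e^{-2t}}\Bigr)f(y_i)\,dy\\&+\frac{2}{m\sqrt{\pi(1-e^{-2t})}}\sum_{j=1}^m\int_0^\infty \exp\Bigl[\frac{-4xy\,e^{-t}-(x^2+y^2)(1+e^{-2t})}{2(1-e^{-2t})}\Bigr]f(y_j)\,dy,\end{aligned}$$ such that for every $f\in C_b(\mathcal S_m)$ the problem $(\mathrm P_B)$ has exactly one classical solution $u$,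 and $u(t,x)=(U_m(t)f)(x)$ for all $t\ge0$ and $x\in\mathcal S_m$. -/

import Mathlib

open MeasureTheory Set
open scoped NNReal ENNReal BoundedContinuousFunction ContDiff

noncomputable section

/-- The relation on `m` disjoint half-lines `[0, ∞)` that identifies all the origins. -/
def starSetoid (m : ℕ) : Setoid (Fin m × ℝ≥0) where
  r p q := p = q ∨ (p.2 = 0 ∧ q.2 = 0)
  iseqv :=
    { refl := fun _ => Or.inl rfl
      symm := by
        rintro p q (h | ⟨h, h'⟩)
        · exact Or.inl h.symm
        · exact Or.inr ⟨h', h⟩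
      trans := by
        rintro p q r (rfl | ⟨h, h'⟩) (rfl | ⟨k, k'⟩)
        · exact Or.inl rfl
        · exact Or.inr ⟨k, k'⟩
        · exact Or.inr ⟨h, h'⟩
        · exact Or.inr ⟨h, k'⟩ }

/-- The metric star graph with `m` semi-infinite rays. -/
def StarGraph (m : ℕ) : Type := Quotient (starSetoid m)

namespace StarGraph

/-- The quotient topology; since there are finitely many rays, it is the topology of the
path metric. -/
instance (m : ℕ) : TopologicalSpace (StarGraph m) :=
  inferInstanceAs (TopologicalSpace (Quotient (starSetoid m)))

/-- The point `x_i` at distance `x` from the vertex on the `i`-th ray. -/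
def pt {m : ℕ} (i : Fin m) (x : ℝ≥0) : StarGraph m := Quotient.mk (starSetoid m) (i, x)

/-- The `i`-th component of a function on the star graph, as a function of a real variable;
only its values on `[0, ∞)` are meaningful. -/
def onRay {m : ℕ} {E : Type*} (f : StarGraph m → E) (i : Fin m) (x : ℝ) : E :=
  f (pt i x.toNNReal)

end StarGraph

/-- `h` is the weak derivative of `g` on the open half-line `(0, ∞)`. -/
structure IsWeakDeriv {𝕜 : Type*} [RCLike 𝕜] (g h : ℝ → 𝕜) : Prop where
  locallyIntegrable : LocallyIntegrableOn g (Ioi 0)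
  locallyIntegrable_deriv : LocallyIntegrableOn h (Ioi 0)
  integral_eq : ∀ φ : ℝ → ℝ, ContDiff ℝ ∞ φ → HasCompactSupport φ → tsupport φ ⊆ Ioi 0 →
    ∫ x in Ioi (0 : ℝ), deriv φ x • g x = -∫ x in Ioi (0 : ℝ), φ x • h x

/-- The space `W^{k,p}_loc` of the closed half-line `[0, ∞)`: the weak derivatives up to order `k`
exist and are in `L^p(0, R)` for every `R`. -/
def MemSobolevLoc {𝕜 : Type*} [RCLike 𝕜] (p : ℝ≥0∞) : ℕ → (ℝ → 𝕜) → Prop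
  | 0, g => ∀ R : ℝ, MemLp g p (volume.restrict (Ioo 0 R))
  | k + 1, g => (∀ R : ℝ, MemLp g p (volume.restrict (Ioo 0 R))) ∧
      ∃ h : ℝ → 𝕜, IsWeakDeriv g h ∧ MemSobolevLoc p k h

/-- The Kirchhoff condition: the derivatives at the vertex along the `m` rays exist and
sum up to zero. -/
def Kirchhoff {𝕜 : Type*} [RCLike 𝕜] {m : ℕ} (f : StarGraph m → 𝕜) : Prop :=
  ∃ d : Fin m → 𝕜, (∀ i, HasDerivWithinAt (StarGraph.onRay f i) (d i) (Ici 0) 0) ∧ ∑ i, d i = 0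

/-- The continuous function `g` is (a representative of) `½ (f'' - |x|² f + f)`, with `f''` the weak
second derivative along the rays. It is determined by `f`. -/
def IsHarmonicImage {𝕜 : Type*} [RCLike 𝕜] {m : ℕ} (f g : StarGraph m →ᵇ 𝕜) : Prop :=
  ∀ i : Fin m, ∃ f₁ f₂ : ℝ → 𝕜,
    IsWeakDeriv (StarGraph.onRay f i) f₁ ∧ IsWeakDeriv f₁ f₂ ∧
    ∀ᵐ x ∂(volume.restrict (Ioi (0 : ℝ))),
      StarGraph.onRay g i x =
        (1 / 2 : 𝕜) * (f₂ x - (x : 𝕜) ^ 2 * StarGraph.onRay f i x + StarGraph.onRay f i x)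

/-- The domain `D(B)` of the harmonic oscillator `B` in `C_b`. -/
def harmonicDomain (𝕜 : Type*) [RCLike 𝕜] (m : ℕ) : Set (StarGraph m →ᵇ 𝕜) :=
  {f | (∀ p : ℝ≥0∞, 1 ≤ p → p < ⊤ → ∀ i, MemSobolevLoc p 2 (StarGraph.onRay f i)) ∧
    Kirchhoff (f : StarGraph m → 𝕜) ∧ ∃ g : StarGraph m →ᵇ 𝕜, IsHarmonicImage f g}

/-- The function `u(t, ·)`. -/
def timeSlice {𝕜 : Type*} [RCLike 𝕜] {m : ℕ} (u : (ℝ≥0 × StarGraph m) →ᵇ 𝕜) (t : ℝ≥0) :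
    StarGraph m →ᵇ 𝕜 :=
  u.compContinuous ⟨fun x => (t, x), by fun_prop⟩

/-- `u ∈ C_b([0, ∞) × S_m)` is a classical solution of `∂_t u = B u` for `t > 0`, `u(0, ·) = f`. -/
structure IsClassicalSolution {𝕜 : Type*} [RCLike 𝕜] {m : ℕ} (f : StarGraph m →ᵇ 𝕜)
    (u : (ℝ≥0 × StarGraph m) →ᵇ 𝕜) : Prop where
  contDiffOn : ∀ x, ContDiffOn ℝ 1 (fun t : ℝ => u (t.toNNReal, x)) (Ioi 0)
  mem_domain : ∀ t : ℝ≥0, 0 < t → timeSlice u t ∈ harmonicDomain 𝕜 m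
  equation : ∀ t : ℝ≥0, 0 < t → ∃ g : StarGraph m →ᵇ 𝕜, IsHarmonicImage (timeSlice u t) g ∧
    ∀ x, deriv (fun s : ℝ => u (s.toNNReal, x)) (t : ℝ) = g x
  initial : ∀ x, u (0, x) = f x

/-- The Mehler-type formula on the star graph, at time `t` and at the point at distance `x` from the
vertex on the `i`-th ray. -/
def mehlerStar {𝕜 : Type*} [RCLike 𝕜] {m : ℕ} (t : ℝ) (f : StarGraph m → 𝕜) (i : Fin m)
    (x : ℝ) : 𝕜 :=
  (2 / √(Real.pi * (1 - Real.exp (-2 * t)))) •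
      (∫ y in Ioi (0 : ℝ),
        (Real.exp (-((1 + Real.exp (-2 * t)) * (x ^ 2 + y ^ 2) / (2 * (1 - Real.exp (-2 * t))))) *
          Real.sinh (2 * x * y * Real.exp (-t) / (1 - Real.exp (-2 * t)))) •
            StarGraph.onRay f i y) +
    (2 / ((m : ℝ) * √(Real.pi * (1 - Real.exp (-2 * t))))) •
      (∑ j : Fin m, ∫ y in Ioi (0 : ℝ),
        Real.exp ((-4 * x * y * Real.exp (-t) - (x ^ 2 + y ^ 2) * (1 + Real.exp (-2 * t))) /
          (2 * (1 - Real.exp (-2 * t)))) • StarGraph.onRay f j y)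

end

/-! ### Weak derivatives on the half-line -/

section WeakDerivative

open Filter Topology

variable {𝕜 : Type*} [RCLike 𝕜]

/-! Existence is reduced to the whole line by reflection. Extend each component `f_i` to a bounded
continuous function `e_i` on the line by `e_i(-y) = (2/m) ∑_j f_j(y) - f_i(y)` (`reflectExt`). Then
every difference `e_i - e_j` is odd and `∑ e_i` is even. The Mehler kernel is invariant under `(x,
y) ↦ (-x, -y)`, so these parities persist in time: at `x = 0` oddness of the differences gives equal
values on all rays, and evenness of the sum makes the derivatives add up to zero, which is the
Kirchhoff condition. Folding the negative half-line back onto the rays turns the Mehler integral of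
`e_i` into the stated formula (`gaussMoment_reflectExt`).

The evolution on the line is written in two ways. For `t > 0`, as an integral against the Mehler
kernel (`mehlerMoment`), it can be differentiated under the integral sign: all derivatives are
combinations of higher moments, the equation becomes an identity between hyperbolic functions, and
fast decay in `x` makes `x² u` bounded. As an average over a standard Gaussian variable
(`mehlerAverage`) it has no singularity at `t = 0`, which gives joint continuity, the uniform bound
and the initial value.

Uniqueness is a maximum principle (`nonpos_of_harmonic_evolution`) with a quadratic barrier; at the
vertex the Kirchhoff condition replaces the vanishing of the derivative at an interior maximum. It
needs pointwise derivatives up to the vertex, and these come from du Bois-Reymond: the equation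
shows that the weak second derivative has a continuous representative. The semigroup law then
follows from uniqueness, since a time translate of a solution is a solution. -/

theorem setIntegral_Ioi_smul_eq {φ : ℝ → ℝ} (hφ : tsupport φ ⊆ Ioi 0) (g : ℝ → 𝕜) :
    ∫ x in Ioi (0 : ℝ), φ x • g x = ∫ x, φ x • g x :=
  setIntegral_eq_integral_of_forall_compl_eq_zero fun x hx => by
    rw [image_eq_zero_of_notMem_tsupport fun h => hx (hφ h), zero_smul]

/-- Multiplying a locally integrable function on `(0, ∞)` by a test function gives an integrable
function. -/
theorem integrable_testFunction_smul {g : ℝ → 𝕜} (hg : LocallyIntegrableOn g (Ioi 0))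
    {φ : ℝ → ℝ} (hc : Continuous φ) (hs : HasCompactSupport φ) (hφ : tsupport φ ⊆ Ioi 0) :
    Integrable fun x => φ x • g x := by
  have h : IntegrableOn (fun x => φ x • g x) (tsupport φ) :=
    (hg.integrableOn_compact_subset hφ hs.isCompact).continuousOn_smul hc.continuousOn hs.isCompact
  refine (integrableOn_iff_integrable_of_support_subset ?_).1 h
  exact (Function.support_smul_subset_left _ _).trans (subset_tsupport φ)

theorem integral_deriv_smul_of_hasDerivAt {g g' : ℝ → 𝕜} (hg : ∀ x, HasDerivAt g (g' x) x)
    (hg' : Continuous g') {φ : ℝ → ℝ} (hφ : ContDiff ℝ ∞ φ) (hs : HasCompactSupport φ) :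
    ∫ x, deriv φ x • g x = -∫ x, φ x • g' x := by
  have hgc : Continuous g := continuous_iff_continuousAt.2 fun x => (hg x).continuousAt
  have hφ' : Continuous (deriv φ) := hφ.continuous_deriv (by simp)
  have key := integral_bilinear_hasDerivAt_right_eq_neg_left_of_integrable
    (L := ContinuousLinearMap.lsmul ℝ ℝ (E := 𝕜)) (u := φ) (v := g) (u' := deriv φ) (v' := g')
    (fun x _ => (hφ.differentiable (by simp) x).hasDerivAt) (fun x _ => hg x)
    ((hφ.continuous.smul hg').integrable_of_hasCompactSupport hs.smul_right)
    ((hφ'.smul hgc).integrable_of_hasCompactSupport hs.deriv.smul_right)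
    ((hφ.continuous.smul hgc).integrable_of_hasCompactSupport hs.smul_right)
  simp only [ContinuousLinearMap.lsmul_apply] at key
  rw [key, neg_neg]

/-- A continuously differentiable function has its derivative as weak derivative. -/
theorem IsWeakDeriv.of_hasDerivAt {f g g' : ℝ → 𝕜} (hf : ∀ x, 0 ≤ x → f x = g x)
    (hg : ∀ x, HasDerivAt g (g' x) x) (hg' : Continuous g') : IsWeakDeriv f g' := by
  have hgc : Continuous g := continuous_iff_continuousAt.2 fun x => (hg x).continuousAt
  refine ⟨?_, hg'.locallyIntegrable.locallyIntegrableOn _, fun φ hφ hs ht => ?_⟩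
  · refine (hgc.continuousOn.congr fun x hx => ?_).locallyIntegrableOn measurableSet_Ioi
    exact hf x (le_of_lt hx)
  · rw [setIntegral_congr_fun (g := fun x => deriv φ x • g x) measurableSet_Ioi
        fun x hx => by simp only [hf x (le_of_lt hx)],
      setIntegral_Ioi_smul_eq (tsupport_deriv_subset.trans ht), setIntegral_Ioi_smul_eq ht,
      integral_deriv_smul_of_hasDerivAt hg hg' hφ hs]

/-- Integrate from a point to the left of the support: the primitive vanishes there, and it vanishes
again to the right of the support because the total integral is zero. -/
theorem exists_compactSupport_primitive {ψ : ℝ → ℝ} (hψ : ContDiff ℝ ∞ ψ)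
    (hs : HasCompactSupport ψ) (ht : tsupport ψ ⊆ Ioi 0) (h0 : ∫ x, ψ x = 0) :
    ∃ Ψ : ℝ → ℝ, ContDiff ℝ ∞ Ψ ∧ HasCompactSupport Ψ ∧ tsupport Ψ ⊆ Ioi 0 ∧ deriv Ψ = ψ := by
  obtain ⟨a, ha0, b, hab⟩ : ∃ a : ℝ, 0 < a ∧ ∃ b : ℝ, tsupport ψ ⊆ Icc a b := by
    rcases (tsupport ψ).eq_empty_or_nonempty with he | hne
    · exact ⟨1, one_pos, 1, by simp [he]⟩
    · obtain ⟨a, ha, hal⟩ := hs.isCompact.exists_isLeast hne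
      obtain ⟨b, _, hbl⟩ := hs.isCompact.exists_isGreatest hne
      exact ⟨a, ht ha, b, fun x hx => ⟨hal hx, hbl hx⟩⟩
  have hz : ∀ x, x ∉ Icc a b → ψ x = 0 := fun x hx =>
    image_eq_zero_of_notMem_tsupport fun h => hx (hab h)
  have hd : ∀ x, HasDerivAt (fun x => ∫ y in a..x, ψ y) (ψ x) x := fun x =>
    hψ.continuous.integral_hasStrictDerivAt a x |>.hasDerivAt
  have hder : deriv (fun x => ∫ y in a..x, ψ y) = ψ := funext fun x => (hd x).deriv
  have hsupp : tsupport (fun x => ∫ y in a..x, ψ y) ⊆ Icc a b := by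
    refine closure_minimal (fun x hx => ?_) isClosed_Icc
    by_contra hxn
    refine hx ?_
    by_cases hxa : x ≤ a
    · have : EqOn ψ (fun _ => 0) (uIcc a x) := by
        have hfr : ∀ y, y < a → ψ y = 0 := fun y hy => hz y fun h => absurd h.1 (not_le.2 hy)
        have hcl : EqOn ψ (fun _ => 0) (closure (Iio a)) :=
          EqOn.closure (fun y hy => hfr y hy) hψ.continuous continuous_const
        rw [closure_Iio] at hcl
        rw [uIcc_of_ge hxa]
        exact fun y hy => hcl hy.2
      simp only [intervalIntegral.integral_congr this, intervalIntegral.integral_zero]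
    · push Not at hxa
      have hxb : b < x := by
        by_contra hc
        exact hxn ⟨hxa.le, not_lt.1 hc⟩
      have : ∫ y in a..x, ψ y = ∫ y, ψ y := by
        refine intervalIntegral.integral_eq_integral_of_support_subset fun y hy => ?_
        have hy' := hab (subset_tsupport ψ hy)
        refine ⟨lt_of_le_of_ne hy'.1 ?_, hy'.2.trans hxb.le⟩
        -- The interval integral is over `(a, x]`, so the endpoint `a` has to be excluded: `ψ`
        -- vanishes to the left of `a`, hence at `a` by continuity.
        rintro rfl
        have hcl : EqOn ψ (fun _ => 0) (closure (Iio a)) :=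
          EqOn.closure (fun y hy => hz y fun h => absurd h.1 (not_le.2 hy)) hψ.continuous
            continuous_const
        rw [closure_Iio] at hcl
        exact hy (hcl self_mem_Iic)
      simp only [this, h0]
  refine ⟨fun x => ∫ y in a..x, ψ y, ?_, ?_, ?_, hder⟩
  · exact contDiff_infty_iff_deriv.2 ⟨fun x => (hd x).differentiableAt, by rwa [hder]⟩
  · exact HasCompactSupport.of_support_subset_isCompact isCompact_Icc
      ((subset_tsupport _).trans hsupp)
  · exact hsupp.trans fun x hx => lt_of_lt_of_le ha0 hx.1

/-- The du Bois-Reymond lemma on the half-line. -/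
theorem ae_eq_const_of_integral_deriv_smul_eq_zero {w : ℝ → 𝕜}
    (hw : LocallyIntegrableOn w (Ioi 0))
    (h : ∀ φ : ℝ → ℝ, ContDiff ℝ ∞ φ → HasCompactSupport φ → tsupport φ ⊆ Ioi 0 →
      ∫ x, deriv φ x • w x = 0) :
    ∃ C : 𝕜, ∀ᵐ x, x ∈ Ioi (0 : ℝ) → w x = C := by
  -- A fixed test function of mass one supported in `[1, 3]`. Subtracting `(∫ φ) ρ` from a test
  -- function `φ` leaves one of zero integral, that is, the derivative of a test function; hence the
  -- constant must be `∫ ρ w`.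
  let B : ContDiffBump (2 : ℝ) := ⟨1 / 2, 1, by norm_num, by norm_num⟩
  let ρ : ℝ → ℝ := B.normed volume
  have hρ : ContDiff ℝ ∞ ρ := B.contDiff_normed
  have hρs : HasCompactSupport ρ := B.hasCompactSupport_normed
  have hρt : tsupport ρ ⊆ Ioi 0 := by
    rw [B.tsupport_normed_eq]
    intro x hx
    have hx' : |x - 2| ≤ 1 := by simpa [Real.dist_eq] using hx
    have := (abs_le.1 hx').1
    exact mem_Ioi.2 (by linarith)
  have hρ1 : ∫ x, ρ x = 1 := B.integral_normed
  refine ⟨∫ x, ρ x • w x, ?_⟩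
  have key := isOpen_Ioi.ae_eq_zero_of_integral_contDiff_smul_eq_zero (μ := volume)
    (f := fun x => w x - ∫ x, ρ x • w x) (U := Ioi (0 : ℝ))
    (hw.sub (continuous_const.locallyIntegrable.locallyIntegrableOn _)) ?_
  · filter_upwards [key] with x hx hx0
    exact sub_eq_zero.1 (hx hx0)
  · intro φ hφ hs ht
    let r : ℝ := ∫ x, φ x
    have hψt : tsupport (fun x => φ x - r * ρ x) ⊆ Ioi 0 := by
      refine (tsupport_sub φ fun x => r * ρ x).trans (union_subset ht ?_)
      exact (tsupport_mul_subset_right (f := fun _ => r) (g := ρ)).trans hρt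
    have hφi : Integrable φ := hφ.continuous.integrable_of_hasCompactSupport hs
    have hρi : Integrable ρ := hρ.continuous.integrable_of_hasCompactSupport hρs
    obtain ⟨Ψ, h1, h2, h3, h4⟩ := exists_compactSupport_primitive
      (ψ := fun x => φ x - r * ρ x) (hφ.sub (contDiff_const.mul hρ))
      (hs.sub (hρs.mul_left (f := fun _ => r))) hψt (by
        rw [integral_sub hφi (hρi.const_mul r), integral_const_mul, hρ1, mul_one, sub_self])
    have h5 := h Ψ h1 h2 h3
    rw [h4] at h5
    have i1 := integrable_testFunction_smul hw hφ.continuous hs ht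
    have i2 := integrable_testFunction_smul hw hρ.continuous hρs hρt
    have h6 : ∫ x, φ x • w x = r • ∫ x, ρ x • w x := by
      have : (fun x => (φ x - r * ρ x) • w x) = fun x => φ x • w x - r • (ρ x • w x) := by
        funext x
        rw [sub_smul, mul_smul]
      rw [this, integral_sub i1 (i2.smul r : Integrable fun x => r • (ρ x • w x)),
        integral_smul] at h5
      exact sub_eq_zero.1 h5
    simp only [smul_sub]
    rw [integral_sub i1 (hφi.smul_const _), h6, integral_smul_const, sub_self]

/-- A function on the half-line whose weak derivative has a continuous representative is a
primitive of it. -/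
theorem IsWeakDeriv.ae_eq_primitive {g h k : ℝ → 𝕜} (hgh : IsWeakDeriv g h) (hk : Continuous k)
    (hhk : ∀ᵐ x, x ∈ Ioi (0 : ℝ) → h x = k x) :
    ∃ C : 𝕜, ∀ᵐ x, x ∈ Ioi (0 : ℝ) → g x = C + ∫ y in (0 : ℝ)..x, k y := by
  have hd : ∀ x, HasDerivAt (fun x => ∫ y in (0 : ℝ)..x, k y) (k x) x := fun x =>
    (hk.integral_hasStrictDerivAt 0 x).hasDerivAt
  have hP : Continuous fun x => ∫ y in (0 : ℝ)..x, k y :=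
    continuous_iff_continuousAt.2 fun x => (hd x).continuousAt
  have hPl := hP.locallyIntegrable.locallyIntegrableOn (μ := volume) (Ioi 0)
  have h0 : ∀ φ : ℝ → ℝ, ContDiff ℝ ∞ φ → HasCompactSupport φ → tsupport φ ⊆ Ioi 0 →
      ∫ x, deriv φ x • (g x - ∫ y in (0 : ℝ)..x, k y) = 0 := by
    intro φ hφ hs ht
    have ht' := tsupport_deriv_subset.trans ht
    have hφ' : Continuous (deriv φ) := hφ.continuous_deriv (by simp)
    simp only [smul_sub]
    rw [integral_sub (integrable_testFunction_smul hgh.locallyIntegrable hφ' hs.deriv ht')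
      (integrable_testFunction_smul hPl hφ' hs.deriv ht'),
      integral_deriv_smul_of_hasDerivAt hd hk hφ hs, ← setIntegral_Ioi_smul_eq ht' g,
      hgh.integral_eq φ hφ hs ht, ← setIntegral_Ioi_smul_eq ht, sub_neg_eq_add, neg_add_eq_zero]
    refine setIntegral_congr_ae measurableSet_Ioi ?_
    filter_upwards [hhk] with x hx hx0
    rw [hx hx0]
  obtain ⟨C, hC⟩ := ae_eq_const_of_integral_deriv_smul_eq_zero
    (hgh.locallyIntegrable.sub hPl) h0
  refine ⟨C, ?_⟩
  filter_upwards [hC] with x hx hx0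
  rw [← hx hx0, Pi.sub_apply, sub_add_cancel]

theorem eqOn_Ici_of_ae_eq {f g : ℝ → 𝕜} (hf : Continuous f) (hg : Continuous g)
    (h : ∀ᵐ x, x ∈ Ioi (0 : ℝ) → f x = g x) : EqOn f g (Ici 0) := by
  have h1 : EqOn f g (Ioi 0) :=
    Measure.eqOn_open_of_ae_eq (μ := volume) ((ae_restrict_iff' measurableSet_Ioi).2 h) isOpen_Ioi
      hf.continuousOn hg.continuousOn
  simpa using h1.closure hf hg

theorem StarGraph.continuous_pt {m : ℕ} (i : Fin m) : Continuous (StarGraph.pt i) :=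
  continuous_quotient_mk'.comp (by fun_prop)

theorem StarGraph.continuous_onRay {m : ℕ} {E : Type*} [TopologicalSpace E]
    {f : StarGraph m → E} (hf : Continuous f) (i : Fin m) : Continuous (StarGraph.onRay f i) :=
  hf.comp ((StarGraph.continuous_pt i).comp continuous_real_toNNReal)

/-- A bounded continuous function on the star graph whose image under the harmonic oscillator is
continuous is twice continuously differentiable along the closed rays. -/
theorem IsHarmonicImage.exists_hasDerivWithinAt {m : ℕ} {f g : StarGraph m →ᵇ 𝕜}
    (h : IsHarmonicImage f g) (i : Fin m) :
    ∃ f' : ℝ → 𝕜, (∀ x, 0 ≤ x → HasDerivWithinAt (StarGraph.onRay f i) (f' x) (Ici 0) x) ∧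
      ∀ x, HasDerivAt f' (2 * StarGraph.onRay g i x + (x : 𝕜) ^ 2 * StarGraph.onRay f i x -
        StarGraph.onRay f i x) x := by
  obtain ⟨f₁, f₂, h1, h2, h3⟩ := h i
  have hfc := StarGraph.continuous_onRay f.continuous i
  have hgc := StarGraph.continuous_onRay g.continuous i
  set k : ℝ → 𝕜 := fun x => 2 * StarGraph.onRay g i x + (x : 𝕜) ^ 2 * StarGraph.onRay f i x -
    StarGraph.onRay f i x with hkdef
  have hk : Continuous k := by
    have := RCLike.continuous_ofReal (K := 𝕜)
    fun_prop
  -- Solved for `f₂`, the equation exhibits the continuous representative `k`; integrating it twice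
  -- recovers the component, first almost everywhere and then, by continuity, on the closed ray.
  obtain ⟨C, hC⟩ := h2.ae_eq_primitive hk (by
    filter_upwards [(ae_restrict_iff' measurableSet_Ioi).1 h3] with x hx hx0
    rw [hkdef]
    simp only
    rw [hx hx0]
    ring)
  have hd : ∀ x, HasDerivAt (fun x => C + ∫ y in (0 : ℝ)..x, k y) (k x) x := fun x =>
    (hk.integral_hasStrictDerivAt 0 x).hasDerivAt.const_add C
  have hc1 : Continuous fun x => C + ∫ y in (0 : ℝ)..x, k y :=
    continuous_iff_continuousAt.2 fun x => (hd x).continuousAt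
  obtain ⟨A, hA⟩ := h1.ae_eq_primitive hc1 hC
  have hd' : ∀ x, HasDerivAt (fun x => A + ∫ y in (0 : ℝ)..x, (C + ∫ z in (0 : ℝ)..y, k z))
      (C + ∫ y in (0 : ℝ)..x, k y) x := fun x =>
    (hc1.integral_hasStrictDerivAt 0 x).hasDerivAt.const_add A
  have heq := eqOn_Ici_of_ae_eq hfc
    (continuous_iff_continuousAt.2 fun x => (hd' x).continuousAt) hA
  exact ⟨_, fun x hx => (hd' x).hasDerivWithinAt.congr heq (heq hx), hd⟩

theorem memLp_Ioo_of_eq_continuous {f g : ℝ → 𝕜} (hf : ∀ x, 0 ≤ x → f x = g x)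
    (hg : Continuous g) (p : ℝ≥0∞) (R : ℝ) : MemLp f p (volume.restrict (Ioo 0 R)) := by
  obtain ⟨C, hC⟩ := isCompact_Icc.exists_bound_of_continuousOn (s := Icc (0 : ℝ) R) hg.continuousOn
  have h : MemLp g p (volume.restrict (Ioo 0 R)) := by
    refine MemLp.of_bound hg.aestronglyMeasurable C ?_
    exact (ae_restrict_iff' measurableSet_Ioo).2
      (Eventually.of_forall fun x hx => hC x ⟨hx.1.le, hx.2.le⟩)
  refine (memLp_congr_ae ?_).1 h
  exact (ae_restrict_iff' measurableSet_Ioo).2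
    (Eventually.of_forall fun x hx => (hf x hx.1.le).symm)

end WeakDerivative

/-! ### The maximum principle on the star graph and uniqueness -/

section MaximumPrinciple

open Filter Topology

theorem HasDerivWithinAt.nonpos_of_forall_Ici_le {F : ℝ → ℝ} {x₀ d : ℝ}
    (hF : HasDerivWithinAt F d (Ici x₀) x₀) (hmax : ∀ x, x₀ ≤ x → F x ≤ F x₀) : d ≤ 0 := by
  rw [hasDerivWithinAt_iff_tendsto_slope, Ici_sdiff_left] at hF
  refine le_of_tendsto hF ?_
  filter_upwards [self_mem_nhdsWithin] with x hx
  rw [slope_def_field]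
  exact div_nonpos_of_nonpos_of_nonneg (sub_nonpos.2 (hmax x (le_of_lt hx)))
    (sub_nonneg.2 (le_of_lt hx))

theorem HasDerivWithinAt.nonneg_of_forall_Icc_le {F : ℝ → ℝ} {a t₀ d : ℝ} (ha : a < t₀)
    (hF : HasDerivWithinAt F d (Iic t₀) t₀) (hmax : ∀ t ∈ Icc a t₀, F t ≤ F t₀) : 0 ≤ d := by
  rw [hasDerivWithinAt_iff_tendsto_slope, Iic_sdiff_right] at hF
  refine ge_of_tendsto hF ?_
  filter_upwards [Ioo_mem_nhdsLT ha] with t ht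
  rw [slope_def_field]
  exact div_nonneg_of_nonpos (sub_nonpos.2 (hmax t ⟨ht.1.le, ht.2.le⟩)) (sub_nonpos.2 ht.2.le)

/-- One-sided second derivative test. -/
theorem second_deriv_nonpos_of_forall_Ici_le {F F' : ℝ → ℝ} {x₀ d : ℝ}
    (hF : ∀ x, x₀ ≤ x → HasDerivWithinAt F (F' x) (Ici x₀) x)
    (hF' : HasDerivWithinAt F' d (Ici x₀) x₀) (h0 : F' x₀ = 0)
    (hmax : ∀ x, x₀ ≤ x → F x ≤ F x₀) : d ≤ 0 := by
  by_contra! hd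
  rw [hasDerivWithinAt_iff_tendsto_slope, Ici_sdiff_left] at hF'
  -- If `d > 0`, then `F'` is positive just to the right of `x₀`, and the mean value theorem makes
  -- `F` exceed its maximum.
  have hev : ∀ᶠ x in 𝓝[>] x₀, 0 < F' x := by
    filter_upwards [hF'.eventually (lt_mem_nhds hd), self_mem_nhdsWithin] with x hx hx0
    rw [slope_def_field, h0, sub_zero] at hx
    exact (div_pos_iff_of_pos_right (sub_pos.2 hx0)).1 hx
  obtain ⟨b, hb, hbs⟩ := mem_nhdsGT_iff_exists_Ioo_subset.1 hev
  have hb' : x₀ < b := hb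
  set c := (x₀ + b) / 2
  have hc : x₀ < c := by simp only [c]; linarith
  have hcb : c < b := by simp only [c]; linarith
  obtain ⟨y, hy, hye⟩ := exists_hasDerivAt_eq_slope F F' hc
    (fun x hx => (hF x hx.1).continuousWithinAt.mono Icc_subset_Ici_self)
    (fun x hx => (hF x hx.1.le).hasDerivAt (Ici_mem_nhds hx.1))
  have h1 : 0 < F' y := hbs ⟨hy.1, hy.2.trans hcb⟩
  rw [hye, div_pos_iff_of_pos_right (sub_pos.2 hc)] at h1
  linarith [hmax c hc.le]

/-- Maximum principle for `∂_t w = ½ (w'' - x² w + w)` on the star graph. -/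
theorem nonpos_of_harmonic_evolution {m : ℕ} {w : Fin m → ℝ → ℝ → ℝ}
    (hcont : ∀ i, Continuous fun p : ℝ × ℝ => w i p.1 p.2) {M : ℝ}
    (hM : ∀ i t x, w i t x ≤ M) (hinit : ∀ i x, 0 ≤ x → w i 0 x ≤ 0)
    (hvertex : ∀ i j t, w i t 0 = w j t 0)
    (heq : ∀ t, 0 < t → ∃ w' : Fin m → ℝ → ℝ, ∃ w'' : Fin m → ℝ → ℝ,
      (∀ i x, 0 ≤ x → HasDerivWithinAt (w i t) (w' i x) (Ici 0) x) ∧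
      (∀ i x, 0 ≤ x → HasDerivWithinAt (w' i) (w'' i x) (Ici 0) x) ∧
      (∑ i, w' i 0 = 0) ∧
      ∀ i x, 0 ≤ x → HasDerivAt (fun s => w i s x)
        (1 / 2 * (w'' i x - x ^ 2 * w i t x + w i t x)) t)
    (i : Fin m) {t x : ℝ} (ht : 0 ≤ t) (hx : 0 ≤ x) : w i t x ≤ 0 := by
  -- The factor `e^{-t}` turns the zero-order coefficient `(1 - x²)/2` into `-(1 + x²)/2`. The
  -- barrier `ψ = ε (2 + x²)` satisfies `ψ''/2 = ε ≤ (1 + x²) ψ / 2`, with equality at `x = 0`; this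
  -- fixes the constant 2.
  suffices H : ∀ ε, 0 < ε → Real.exp (-t) * w i t x ≤ ε * (2 + x ^ 2) by
    have h1 : Real.exp (-t) * w i t x ≤ 0 := by
      refine le_of_forall_pos_le_add fun δ hδ => ?_
      have h2 : (0 : ℝ) < 2 + x ^ 2 := by positivity
      have := H (δ / (2 + x ^ 2)) (by positivity)
      rwa [div_mul_cancel₀ _ h2.ne', ← zero_add δ] at this
    by_contra! hw
    exact absurd h1 (not_le.2 (mul_pos (Real.exp_pos _) hw))
  intro ε hε
  by_contra! hpos
  let Y : Fin m × ℝ × ℝ → ℝ := fun p =>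
    Real.exp (-p.2.1) * w p.1 p.2.1 p.2.2 - ε * (2 + p.2.2 ^ 2)
  have hYc : Continuous Y := by
    rw [continuous_prod_of_discrete_left]
    intro j
    have := hcont j
    simp only [Y]
    fun_prop
  -- Beyond distance `R` the barrier exceeds the bound `M`, so a positive supremum of `Y` is
  -- attained on a compact set.
  obtain ⟨R, hR0, hR⟩ : ∃ R : ℝ, 0 ≤ R ∧ |M| ≤ ε * R ^ 2 :=
    ⟨√(|M| / ε), Real.sqrt_nonneg _, by
      rw [Real.sq_sqrt (by positivity), mul_div_cancel₀ _ hε.ne']⟩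
  have hfar : ∀ j s y, 0 ≤ s → R ≤ y → Y (j, s, y) < 0 := by
    intro j s y hs hy
    have h1 : Real.exp (-s) * w j s y ≤ |M| := by
      have e1 : Real.exp (-s) ≤ 1 := Real.exp_le_one_iff.2 (by linarith)
      calc Real.exp (-s) * w j s y ≤ Real.exp (-s) * |M| :=
            mul_le_mul_of_nonneg_left ((hM j s y).trans (le_abs_self M)) (Real.exp_pos _).le
        _ ≤ 1 * |M| := mul_le_mul_of_nonneg_right e1 (abs_nonneg M)
        _ = |M| := one_mul _
    have h2 : R ^ 2 ≤ y ^ 2 := pow_le_pow_left₀ hR0 hy 2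
    simp only [Y]
    nlinarith [mul_le_mul_of_nonneg_left h2 hε.le]
  have hK : IsCompact ((univ : Set (Fin m)) ×ˢ Icc (0 : ℝ) t ×ˢ Icc (0 : ℝ) R) :=
    isCompact_univ.prod (isCompact_Icc.prod isCompact_Icc)
  have hYpos : 0 < Y (i, t, x) := sub_pos.2 hpos
  have hmem : (i, t, x) ∈ (univ : Set (Fin m)) ×ˢ Icc (0 : ℝ) t ×ˢ Icc (0 : ℝ) R := by
    refine ⟨mem_univ _, ⟨ht, le_rfl⟩, hx, ?_⟩
    by_contra! hc
    exact absurd (hfar i t x ht hc.le) (not_lt.2 hYpos.le)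
  obtain ⟨⟨i₀, t₀, x₀⟩, ⟨-, ht₀, hx₀⟩, hmaxK⟩ := hK.exists_isMaxOn ⟨_, hmem⟩ hYc.continuousOn
  simp only at ht₀ hx₀
  have hY₀ : 0 < Y (i₀, t₀, x₀) := lt_of_lt_of_le hYpos (hmaxK hmem)
  have hmax : ∀ j s y, s ∈ Icc 0 t → 0 ≤ y → Y (j, s, y) ≤ Y (i₀, t₀, x₀) := by
    intro j s y hs hy
    rcases le_total y R with h | h
    · exact hmaxK (show (j, s, y) ∈ _ from ⟨mem_univ _, hs, hy, h⟩)
    · exact (hfar j s y hs.1 h).le.trans hY₀.le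
  have ht₀' : 0 < t₀ := by
    rcases ht₀.1.eq_or_lt with h | h
    · exfalso
      subst h
      have := hinit i₀ x₀ hx₀.1
      simp only [Y, neg_zero, Real.exp_zero, one_mul] at hY₀
      nlinarith [sq_nonneg x₀]
    · exact h
  obtain ⟨w', w'', h1, h2, h3, h4⟩ := heq t₀ ht₀'
  have hd1 : ∀ j y, 0 ≤ y → HasDerivWithinAt (fun y => Y (j, t₀, y))
      (Real.exp (-t₀) * w' j y - ε * (2 * y)) (Ici 0) y := by
    intro j y hy
    have hq : HasDerivAt (fun y : ℝ => ε * (2 + y ^ 2)) (ε * (2 * y)) y := by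
      simpa using (((hasDerivAt_id y).pow 2).const_add 2).const_mul ε
    exact ((h1 j y hy).const_mul (Real.exp (-t₀))).sub hq.hasDerivWithinAt
  have hd2 : HasDerivWithinAt (fun y => Real.exp (-t₀) * w' i₀ y - ε * (2 * y))
      (Real.exp (-t₀) * w'' i₀ x₀ - ε * 2) (Ici 0) x₀ := by
    have hq : HasDerivAt (fun y : ℝ => ε * (2 * y)) (ε * 2) x₀ := by
      simpa using ((hasDerivAt_id x₀).const_mul 2).const_mul ε
    exact ((h2 i₀ x₀ hx₀.1).const_mul _).sub hq.hasDerivWithinAt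
  have hsub : Ici x₀ ⊆ Ici 0 := Ici_subset_Ici.2 hx₀.1
  -- A maximum at the vertex is a maximum along every ray, so all outgoing derivatives are
  -- nonpositive; as they sum to zero, each vanishes.
  have hslope : Real.exp (-t₀) * w' i₀ x₀ - ε * (2 * x₀) = 0 := by
    rcases hx₀.1.eq_or_lt with h | h
    · subst h
      have hle : ∀ j, w' j 0 ≤ 0 := by
        intro j
        have := (hd1 j 0 le_rfl).nonpos_of_forall_Ici_le fun y hy => by
          have e : Y (j, t₀, 0) = Y (i₀, t₀, 0) := by simp only [Y, hvertex j i₀ t₀]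
          rw [e]
          exact hmax j t₀ y ht₀ hy
        simp only [mul_zero, sub_zero] at this
        by_contra! hc
        exact absurd this (not_le.2 (mul_pos (Real.exp_pos _) hc))
      have : w' i₀ 0 = 0 := (Finset.sum_eq_zero_iff_of_nonpos fun j _ => hle j).1 h3 i₀
        (Finset.mem_univ _)
      simp [this]
    · have hloc : IsLocalMax (fun y => Y (i₀, t₀, y)) x₀ := by
        filter_upwards [Ici_mem_nhds h] with y hy
        exact hmax i₀ t₀ y ht₀ hy
      exact hloc.hasDerivAt_eq_zero ((hd1 i₀ x₀ hx₀.1).hasDerivAt (Ici_mem_nhds h))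
  -- The one-sided test treats the vertex and interior points alike.
  have hsecond : Real.exp (-t₀) * w'' i₀ x₀ - ε * 2 ≤ 0 :=
    second_deriv_nonpos_of_forall_Ici_le (x₀ := x₀)
      (fun y hy => (hd1 i₀ y (hx₀.1.trans hy)).mono hsub) (hd2.mono hsub) hslope
      fun y hy => hmax i₀ t₀ y ht₀ (hx₀.1.trans hy)
  have htime : HasDerivAt (fun s => Y (i₀, s, x₀))
      (-Real.exp (-t₀) * w i₀ t₀ x₀ +
        Real.exp (-t₀) * (1 / 2 * (w'' i₀ x₀ - x₀ ^ 2 * w i₀ t₀ x₀ + w i₀ t₀ x₀))) t₀ := by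
    have he : HasDerivAt (fun s : ℝ => Real.exp (-s)) (-Real.exp (-t₀)) t₀ := by
      simpa using (hasDerivAt_id t₀).neg.exp
    exact (he.mul (h4 i₀ x₀ hx₀.1)).sub_const (ε * (2 + x₀ ^ 2))
  -- Only earlier times are compared, since `t₀` may be the final time `t`.
  have hge := htime.hasDerivWithinAt.nonneg_of_forall_Icc_le ht₀' fun s hs =>
    hmax i₀ s x₀ ⟨hs.1, hs.2.trans ht₀.2⟩ hx₀.1
  have hY₁ : ε * (2 + x₀ ^ 2) < Real.exp (-t₀) * w i₀ t₀ x₀ := sub_pos.1 hY₀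
  have h5 : (x₀ ^ 2 + 1) * (ε * (2 + x₀ ^ 2)) < (x₀ ^ 2 + 1) * (Real.exp (-t₀) * w i₀ t₀ x₀) :=
    mul_lt_mul_of_pos_left hY₁ (by positivity)
  have h6 : 0 ≤ ε * (x₀ ^ 2 * (x₀ ^ 2 + 3)) := by positivity
  nlinarith

end MaximumPrinciple

/-! ### Uniqueness of classical solutions -/

section Uniqueness

variable {𝕜 : Type*} [RCLike 𝕜] {m : ℕ}

theorem StarGraph.exists_eq_pt (p : StarGraph m) : ∃ i x, p = StarGraph.pt i x := by
  obtain ⟨⟨i, x⟩, rfl⟩ := Quotient.exists_rep p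
  exact ⟨i, x, rfl⟩

theorem StarGraph.pt_zero_eq (i j : Fin m) : StarGraph.pt i 0 = StarGraph.pt j 0 :=
  Quotient.sound (Or.inr ⟨rfl, rfl⟩)

theorem IsClassicalSolution.hasDerivAt {f : StarGraph m →ᵇ 𝕜} {u : (ℝ≥0 × StarGraph m) →ᵇ 𝕜}
    (hu : IsClassicalSolution f u) (x : StarGraph m) {t : ℝ} (ht : 0 < t) :
    HasDerivAt (fun s : ℝ => u (s.toNNReal, x)) (deriv (fun s : ℝ => u (s.toNNReal, x)) t) t :=
  (((hu.contDiffOn x).differentiableOn one_ne_zero).differentiableAt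
    (Ioi_mem_nhds ht)).hasDerivAt

/-- Along the closed rays, a classical solution is twice differentiable at positive times, satisfies
the equation there and the Kirchhoff condition at the vertex. -/
theorem IsClassicalSolution.exists_hasDerivWithinAt {f : StarGraph m →ᵇ 𝕜}
    {u : (ℝ≥0 × StarGraph m) →ᵇ 𝕜} (hu : IsClassicalSolution f u) {t : ℝ} (ht : 0 < t) :
    ∃ u' u'' : Fin m → ℝ → 𝕜,
      (∀ i x, 0 ≤ x → HasDerivWithinAt (fun x : ℝ => u (t.toNNReal, StarGraph.pt i x.toNNReal))
        (u' i x) (Ici 0) x) ∧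
      (∀ i x, HasDerivAt (u' i) (u'' i x) x) ∧ (∑ i, u' i 0 = 0) ∧
      ∀ i x, 0 ≤ x → HasDerivAt (fun s : ℝ => u (s.toNNReal, StarGraph.pt i x.toNNReal))
        (1 / 2 * (u'' i x - (x : 𝕜) ^ 2 * u (t.toNNReal, StarGraph.pt i x.toNNReal) +
          u (t.toNNReal, StarGraph.pt i x.toNNReal))) t := by
  have ht' : 0 < t.toNNReal := Real.toNNReal_pos.2 ht
  obtain ⟨g, hg, hgt⟩ := hu.equation t.toNNReal ht'
  obtain ⟨-, ⟨d, hd, hd0⟩, -⟩ := hu.mem_domain t.toNNReal ht'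
  choose u' h1 h2 using fun i => hg.exists_hasDerivWithinAt i
  refine ⟨u', _, h1, h2, ?_, fun i x hx => ?_⟩
  -- One-sided derivatives are unique, so those in the Kirchhoff condition are the values `u' i 0`.
  · rw [← hd0]
    refine Finset.sum_congr rfl fun i _ => ?_
    exact (uniqueDiffOn_Ici 0 0 self_mem_Ici).eq_deriv _ (h1 i 0 le_rfl) (hd i)
  · have h3 := hu.hasDerivAt (StarGraph.pt i x.toNNReal) ht
    have h4 := hgt (StarGraph.pt i x.toNNReal)
    rw [Real.coe_toNNReal t ht.le] at h4
    rw [h4] at h3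
    convert h3 using 1
    simp only [StarGraph.onRay, timeSlice, BoundedContinuousFunction.compContinuous_apply,
      ContinuousMap.coe_mk]
    ring

/-- The equation has real coefficients, so the real-linear functional `z ↦ Re (c z)` maps the
difference of two solutions to a real solution with zero initial value, to which the maximum
principle applies. -/
theorem IsClassicalSolution.re_mul_sub_nonpos {f : StarGraph m →ᵇ 𝕜}
    {u v : (ℝ≥0 × StarGraph m) →ᵇ 𝕜} (hu : IsClassicalSolution f u)
    (hv : IsClassicalSolution f v) (c : 𝕜) (i : Fin m) (t x : ℝ≥0) :
    RCLike.re (c * (u (t, StarGraph.pt i x) - v (t, StarGraph.pt i x))) ≤ 0 := by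
  let L : 𝕜 →L[ℝ] ℝ :=
    RCLike.reCLM.comp ((ContinuousLinearMap.mul ℝ 𝕜) c)
  have hL : ∀ z, L z = RCLike.re (c * z) := fun z => rfl
  have hLr : ∀ (r : ℝ) (z : 𝕜), L ((r : 𝕜) * z) = r * L z := fun r z => by
    rw [← RCLike.real_smul_eq_coe_mul, map_smul, smul_eq_mul]
  let w : Fin m → ℝ → ℝ → ℝ := fun i t x =>
    L (u (t.toNNReal, StarGraph.pt i x.toNNReal) - v (t.toNNReal, StarGraph.pt i x.toNNReal))
  have key := nonpos_of_harmonic_evolution (w := w) (M := ‖L‖ * (‖u‖ + ‖v‖)) ?_ ?_ ?_ ?_ ?_ i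
    t.2 x.2
  · simpa [w, hL] using key
  · intro i
    have h1 : Continuous fun p : ℝ × ℝ => ((p.1.toNNReal, StarGraph.pt i p.2.toNNReal) :
        ℝ≥0 × StarGraph m) :=
      (continuous_real_toNNReal.comp continuous_fst).prodMk
        ((StarGraph.continuous_pt i).comp (continuous_real_toNNReal.comp continuous_snd))
    exact L.continuous.comp ((u.continuous.comp h1).sub (v.continuous.comp h1))
  · intro i t x
    refine (le_abs_self _).trans ((L.le_opNorm _).trans ?_)
    refine mul_le_mul_of_nonneg_left ((norm_sub_le _ _).trans ?_) (norm_nonneg _)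
    exact add_le_add (u.norm_coe_le_norm _) (v.norm_coe_le_norm _)
  · intro i x _
    simp [w, hu.initial, hv.initial]
  · intro i j t
    simp only [w, Real.toNNReal_zero, StarGraph.pt_zero_eq i j]
  · intro t ht
    obtain ⟨u', u'', h1, h2, h3, h4⟩ := hu.exists_hasDerivWithinAt ht
    obtain ⟨v', v'', k1, k2, k3, k4⟩ := hv.exists_hasDerivWithinAt ht
    refine ⟨fun i x => L (u' i x - v' i x), fun i x => L (u'' i x - v'' i x), ?_, ?_, ?_, ?_⟩
    · exact fun i x hx => L.hasFDerivAt.comp_hasDerivWithinAt x ((h1 i x hx).sub (k1 i x hx))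
    · exact fun i x _ => (L.hasFDerivAt.comp_hasDerivAt x ((h2 i x).sub (k2 i x))).hasDerivWithinAt
    · rw [← map_sum, Finset.sum_sub_distrib, h3, k3, sub_zero, map_zero]
    · intro i x hx
      have := L.hasFDerivAt.comp_hasDerivAt t ((h4 i x hx).sub (k4 i x hx))
      refine this.congr_deriv ?_
      rw [← mul_sub, show (1 / 2 : 𝕜) = ((1 / 2 : ℝ) : 𝕜) by push_cast; rfl, hLr]
      congr 1
      simp only [w]
      rw [← hLr, ← map_sub, ← map_add]
      congr 1
      push_cast
      ring

theorem IsClassicalSolution.unique {f : StarGraph m →ᵇ 𝕜}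
    {u v : (ℝ≥0 × StarGraph m) →ᵇ 𝕜} (hu : IsClassicalSolution f u)
    (hv : IsClassicalSolution f v) : u = v := by
  ext ⟨t, p⟩
  obtain ⟨i, x, rfl⟩ := p.exists_eq_pt
  -- With `c` the conjugate of `z`, the quantity shown to be nonpositive is `‖z‖²`.
  set z := u (t, StarGraph.pt i x) - v (t, StarGraph.pt i x) with hz
  have h := hu.re_mul_sub_nonpos hv (starRingEnd 𝕜 z) i t x
  rw [← hz, RCLike.conj_mul, ← RCLike.ofReal_pow, RCLike.ofReal_re] at h
  have h0 : ‖z‖ = 0 := pow_eq_zero_iff two_ne_zero |>.1 (le_antisymm h (by positivity))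
  exact sub_eq_zero.1 (norm_eq_zero.1 h0)

end Uniqueness

/-! ### Gaussian moments of bounded continuous functions -/

section GaussianMoments

open Filter Topology

variable {𝕜 : Type*} [RCLike 𝕜]

theorem integrable_abs_pow_mul_exp_neg_mul_sq (n : ℕ) {b : ℝ} (hb : 0 < b) :
    Integrable fun y : ℝ => |y| ^ n * Real.exp (-b * y ^ 2) := by
  have h := (integrable_rpow_mul_exp_neg_mul_sq hb (s := n)
    (lt_of_lt_of_le (by norm_num) n.cast_nonneg)).norm
  refine h.congr (Eventually.of_forall fun y => ?_)
  simp only [Real.rpow_natCast, norm_mul, norm_pow, Real.norm_eq_abs, Real.abs_exp]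

theorem neg_mul_sq_add_le {p : ℝ} (hp : 0 < p) (Q y : ℝ) :
    -p * y ^ 2 / 2 + Q * y ≤ Q ^ 2 / p + -(p / 4) * y ^ 2 := by
  have h : Q ^ 2 / p + -(p / 4) * y ^ 2 - (-p * y ^ 2 / 2 + Q * y) = (p * y / 2 - Q) ^ 2 / p := by
    field_simp
    ring
  have : 0 ≤ (p * y / 2 - Q) ^ 2 / p := by positivity
  linarith

theorem integrable_abs_pow_mul_exp (n : ℕ) {p : ℝ} (hp : 0 < p) (Q : ℝ) :
    Integrable fun y : ℝ => |y| ^ n * Real.exp (-p * y ^ 2 / 2 + Q * |y|) := by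
  refine ((integrable_abs_pow_mul_exp_neg_mul_sq n (b := p / 4) (by positivity)).const_mul
    (Real.exp (Q ^ 2 / p))).mono' (by fun_prop) (Eventually.of_forall fun y => ?_)
  rw [Real.norm_of_nonneg (by positivity), mul_left_comm, ← Real.exp_add]
  refine mul_le_mul_of_nonneg_left (Real.exp_le_exp.2 ?_) (by positivity)
  simpa using neg_mul_sq_add_le hp Q |y|

/-- The `n`-th moment of `e` against the Gaussian weight `exp (-p y² / 2 + q y)`. -/
noncomputable def gaussMoment (e : ℝ →ᵇ 𝕜) (n : ℕ) (p q : ℝ) : 𝕜 :=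
  ∫ y, (y ^ n * Real.exp (-p * y ^ 2 / 2 + q * y)) • e y

theorem integrable_gaussMoment (e : ℝ →ᵇ 𝕜) (n : ℕ) {p : ℝ} (hp : 0 < p) (q : ℝ) :
    Integrable fun y : ℝ => (y ^ n * Real.exp (-p * y ^ 2 / 2 + q * y)) • e y := by
  refine ((integrable_abs_pow_mul_exp n hp |q|).mul_const ‖e‖).mono'
    (by have := e.continuous; fun_prop) (Eventually.of_forall fun y => ?_)
  rw [norm_smul, norm_mul, norm_pow, Real.norm_eq_abs, Real.norm_eq_abs, Real.abs_exp]
  have h1 : q * y ≤ |q| * |y| := by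
    rw [← abs_mul]
    exact le_abs_self _
  refine mul_le_mul (mul_le_mul_of_nonneg_left (Real.exp_le_exp.2 ?_) (by positivity))
    (e.norm_coe_le_norm y) (norm_nonneg _) (by positivity)
  linarith

/-- Differentiation of Gaussian moments along a curve of parameters. -/
theorem hasDerivAt_gaussMoment (e : ℝ →ᵇ 𝕜) (n : ℕ) {p q p' q' : ℝ → ℝ} {s₀ : ℝ}
    (hp : ∀ᶠ s in 𝓝 s₀, HasDerivAt p (p' s) s) (hq : ∀ᶠ s in 𝓝 s₀, HasDerivAt q (q' s) s)
    (hp' : ContinuousAt p' s₀) (hq' : ContinuousAt q' s₀) (h0 : 0 < p s₀) :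
    HasDerivAt (fun s => gaussMoment e n (p s) (q s))
      (-(p' s₀ / 2) • gaussMoment e (n + 2) (p s₀) (q s₀) +
        q' s₀ • gaussMoment e (n + 1) (p s₀) (q s₀)) s₀ := by
  have hpc : ContinuousAt p s₀ := hp.self_of_nhds.continuousAt
  have hqc : ContinuousAt q s₀ := hq.self_of_nhds.continuousAt
  set Q := |q s₀| + 1
  set P' := |p' s₀| + 1
  set Q' := |q' s₀| + 1
  -- Near `s₀` the Gaussian rate stays above half its value and the other parameters stay bounded,
  -- so one integrable function dominates all the derivatives.
  have hS : ∀ᶠ s in 𝓝 s₀, HasDerivAt p (p' s) s ∧ HasDerivAt q (q' s) s ∧ p s₀ / 2 < p s ∧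
      |q s| < Q ∧ |p' s| < P' ∧ |q' s| < Q' := by
    filter_upwards [hp, hq, hpc.eventually (lt_mem_nhds (half_lt_self h0)),
      hqc.abs.eventually (gt_mem_nhds (lt_add_one _)),
      hp'.abs.eventually (gt_mem_nhds (lt_add_one _)),
      hq'.abs.eventually (gt_mem_nhds (lt_add_one _))] with s h1 h2 h3 h4 h5 h6
    exact ⟨h1, h2, h3, h4, h5, h6⟩
  have hp2 : 0 < p s₀ / 2 := half_pos h0
  have key := hasDerivAt_integral_of_dominated_loc_of_deriv_le (μ := volume) hS
    (F := fun s y => (y ^ n * Real.exp (-p s * y ^ 2 / 2 + q s * y)) • e y)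
    (F' := fun s y => (y ^ n * (Real.exp (-p s * y ^ 2 / 2 + q s * y) *
      (-p' s * y ^ 2 / 2 + q' s * y))) • e y)
    (bound := fun y => (P' * (|y| ^ (n + 2) * Real.exp (-(p s₀ / 2) * y ^ 2 / 2 + Q * |y|)) +
      Q' * (|y| ^ (n + 1) * Real.exp (-(p s₀ / 2) * y ^ 2 / 2 + Q * |y|))) * ‖e‖)
    (Eventually.of_forall fun s => by have := e.continuous; fun_prop)
    (integrable_gaussMoment e n h0 _) (by have := e.continuous; fun_prop) ?_ ?_ ?_
  · refine key.2.congr_deriv ?_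
    rw [gaussMoment, gaussMoment, ← integral_smul, ← integral_smul, ← integral_add]
    · refine integral_congr_ae (Eventually.of_forall fun y => ?_)
      simp only [smul_smul, ← add_smul]
      congr 1
      ring
    · exact (integrable_gaussMoment e (n + 2) h0 _).smul _
    · exact (integrable_gaussMoment e (n + 1) h0 _).smul _
  · refine Eventually.of_forall fun y s hs => ?_
    obtain ⟨-, -, h3, h4, h5, h6⟩ := hs
    rw [norm_smul, norm_mul, norm_mul, norm_pow, Real.norm_eq_abs, Real.norm_eq_abs,
      Real.norm_eq_abs, Real.abs_exp]
    refine mul_le_mul ?_ (e.norm_coe_le_norm y) (norm_nonneg _) (by positivity)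
    have e1 : Real.exp (-p s * y ^ 2 / 2 + q s * y) ≤
        Real.exp (-(p s₀ / 2) * y ^ 2 / 2 + Q * |y|) := by
      refine Real.exp_le_exp.2 (add_le_add ?_ ?_)
      · nlinarith [sq_nonneg y]
      · calc q s * y ≤ |q s| * |y| := by rw [← abs_mul]; exact le_abs_self _
          _ ≤ Q * |y| := mul_le_mul_of_nonneg_right h4.le (abs_nonneg y)
    have e2 : |(-p' s * y ^ 2 / 2 + q' s * y)| ≤ P' * |y| ^ 2 + Q' * |y| := by
      refine (abs_add_le _ _).trans (add_le_add ?_ ?_)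
      · rw [abs_div, abs_mul, abs_neg, abs_pow, abs_two]
        have := mul_le_mul_of_nonneg_right h5.le (sq_nonneg |y|)
        have h7 : 0 ≤ |p' s| * |y| ^ 2 := by positivity
        linarith
      · rw [abs_mul]
        exact mul_le_mul_of_nonneg_right h6.le (abs_nonneg y)
    calc |y| ^ n * (Real.exp (-p s * y ^ 2 / 2 + q s * y) * |(-p' s * y ^ 2 / 2 + q' s * y)|)
        ≤ |y| ^ n * (Real.exp (-(p s₀ / 2) * y ^ 2 / 2 + Q * |y|) *
          (P' * |y| ^ 2 + Q' * |y|)) := by gcongr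
      _ = _ := by ring
  · exact (((integrable_abs_pow_mul_exp (n + 2) hp2 Q).const_mul P').add
      ((integrable_abs_pow_mul_exp (n + 1) hp2 Q).const_mul Q')).mul_const _
  · refine Eventually.of_forall fun y s hs => ?_
    obtain ⟨h1, h2, -⟩ := hs
    have h3 : HasDerivAt (fun s => -p s * y ^ 2 / 2 + q s * y) (-p' s * y ^ 2 / 2 + q' s * y) s :=
      ((h1.neg.mul_const (y ^ 2)).div_const 2).add (h2.mul_const y)
    exact (h3.exp.const_mul (y ^ n)).smul_const (e y)

end GaussianMoments

/-! ### The Mehler evolution on the line -/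

section MehlerMoments

open Filter Topology

variable {𝕜 : Type*} [RCLike 𝕜]

/-- The factor of the Mehler kernel `K_t(x, y)` that depends only on `t` and `x`. -/
noncomputable def mehlerWeight (t x : ℝ) : ℝ :=
  √(Real.exp t / (2 * Real.pi * Real.sinh t)) * Real.exp (-(Real.cosh t / Real.sinh t) * x ^ 2 / 2)

/-- The integral `∫ yⁿ K_t(x, y) e(y) dy` with `K` the Mehler kernel. -/
noncomputable def mehlerMoment (e : ℝ →ᵇ 𝕜) (n : ℕ) (t x : ℝ) : 𝕜 :=
  mehlerWeight t x • gaussMoment e n (Real.cosh t / Real.sinh t) (x / Real.sinh t)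

theorem hasDerivAt_coth {t : ℝ} (ht : 0 < t) :
    HasDerivAt (fun t => Real.cosh t / Real.sinh t) (-(1 / Real.sinh t ^ 2)) t := by
  have hs : Real.sinh t ≠ 0 := (Real.sinh_pos_iff.2 ht).ne'
  refine ((Real.hasDerivAt_cosh t).div (Real.hasDerivAt_sinh t) hs).congr_deriv ?_
  have := Real.cosh_sq t
  rw [← neg_div]
  congr 1
  linarith

theorem hasDerivAt_div_sinh (x : ℝ) {t : ℝ} (ht : 0 < t) :
    HasDerivAt (fun t => x / Real.sinh t) (-(x * Real.cosh t / Real.sinh t ^ 2)) t := by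
  have hs : Real.sinh t ≠ 0 := (Real.sinh_pos_iff.2 ht).ne'
  refine ((hasDerivAt_const t x).div (Real.hasDerivAt_sinh t) hs).congr_deriv ?_
  ring

theorem hasDerivAt_mehlerWeight_time (x : ℝ) {t : ℝ} (ht : 0 < t) :
    HasDerivAt (fun t => mehlerWeight t x)
      ((1 / 2 * (1 - Real.cosh t / Real.sinh t) + x ^ 2 / (2 * Real.sinh t ^ 2)) *
        mehlerWeight t x) t := by
  have hs : 0 < Real.sinh t := Real.sinh_pos_iff.2 ht
  have hπ := Real.pi_pos
  set r := Real.exp t / (2 * Real.pi * Real.sinh t) with hr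
  have hr0 : 0 < r := by positivity
  have h1 : HasDerivAt (fun t => Real.exp t / (2 * Real.pi * Real.sinh t))
      (r * (1 - Real.cosh t / Real.sinh t)) t := by
    refine ((Real.hasDerivAt_exp t).div ((Real.hasDerivAt_sinh t).const_mul (2 * Real.pi))
      (by positivity)).congr_deriv ?_
    rw [hr]
    field_simp
  have h2 := h1.sqrt hr0.ne'
  have h3 : HasDerivAt (fun t => Real.exp (-(Real.cosh t / Real.sinh t) * x ^ 2 / 2))
      (Real.exp (-(Real.cosh t / Real.sinh t) * x ^ 2 / 2) *
        (- -(1 / Real.sinh t ^ 2) * x ^ 2 / 2)) t :=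
    (((hasDerivAt_coth ht).neg.mul_const (x ^ 2)).div_const 2).exp
  refine (h2.mul h3).congr_deriv ?_
  simp only [mehlerWeight, ← hr]
  have hsq : √r * √r = r := Real.mul_self_sqrt hr0.le
  have hrs : 0 < √r := Real.sqrt_pos.2 hr0
  have : r * (1 - Real.cosh t / Real.sinh t) / (2 * √r) =
      √r * (1 - Real.cosh t / Real.sinh t) / 2 := by
    rw [div_eq_div_iff (by positivity) (by positivity)]
    linear_combination (-2 * (1 - Real.cosh t / Real.sinh t)) * hsq
  rw [this]
  field_simp

theorem hasDerivAt_mehlerWeight_space (t x : ℝ) :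
    HasDerivAt (mehlerWeight t) (-(Real.cosh t / Real.sinh t) * x * mehlerWeight t x) x := by
  have h : HasDerivAt (fun x : ℝ => -(Real.cosh t / Real.sinh t) * x ^ 2 / 2)
      (-(Real.cosh t / Real.sinh t) * (2 * x) / 2) x := by
    simpa using ((((hasDerivAt_id x).pow 2).const_mul (-(Real.cosh t / Real.sinh t))).div_const 2)
  refine (h.exp.const_mul _).congr_deriv ?_
  simp only [mehlerWeight]
  ring

/-- The moments form a family closed under differentiation, so the same rule gives every derivative
needed. -/
theorem hasDerivAt_mehlerMoment_space (e : ℝ →ᵇ 𝕜) (n : ℕ) {t : ℝ} (ht : 0 < t) (x : ℝ) :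
    HasDerivAt (mehlerMoment e n t)
      (-(Real.cosh t / Real.sinh t * x) • mehlerMoment e n t x +
        (1 / Real.sinh t) • mehlerMoment e (n + 1) t x) x := by
  have hs : 0 < Real.sinh t := Real.sinh_pos_iff.2 ht
  have ha : 0 < Real.cosh t / Real.sinh t := div_pos (Real.cosh_pos t) hs
  have h := hasDerivAt_gaussMoment e n (p := fun _ => Real.cosh t / Real.sinh t)
    (q := fun x => x / Real.sinh t) (p' := fun _ => 0) (q' := fun _ => 1 / Real.sinh t) (s₀ := x)
    (Eventually.of_forall fun s => hasDerivAt_const s _)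
    (Eventually.of_forall fun s => (hasDerivAt_id s).div_const _) continuousAt_const
    continuousAt_const ha
  refine ((hasDerivAt_mehlerWeight_space t x).smul h).congr_deriv ?_
  simp only [mehlerMoment, zero_div, neg_zero, zero_smul, zero_add, smul_smul]
  rw [add_comm, neg_mul (Real.cosh t / Real.sinh t) x, mul_comm (mehlerWeight t x)]

theorem hasDerivAt_mehlerMoment_time (e : ℝ →ᵇ 𝕜) (n : ℕ) {t : ℝ} (ht : 0 < t) (x : ℝ) :
    HasDerivAt (fun t => mehlerMoment e n t x)
      ((1 / 2 * (1 - Real.cosh t / Real.sinh t) + x ^ 2 / (2 * Real.sinh t ^ 2)) •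
          mehlerMoment e n t x +
        (1 / (2 * Real.sinh t ^ 2)) • mehlerMoment e (n + 2) t x -
        (x * Real.cosh t / Real.sinh t ^ 2) • mehlerMoment e (n + 1) t x) t := by
  have hs : 0 < Real.sinh t := Real.sinh_pos_iff.2 ht
  have ha : 0 < Real.cosh t / Real.sinh t := div_pos (Real.cosh_pos t) hs
  have hsc := Real.continuous_sinh.continuousAt (x := t)
  have hcc := Real.continuous_cosh.continuousAt (x := t)
  have h := hasDerivAt_gaussMoment e n (p := fun t => Real.cosh t / Real.sinh t)
    (q := fun t => x / Real.sinh t) (p' := fun t => -(1 / Real.sinh t ^ 2))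
    (q' := fun t => -(x * Real.cosh t / Real.sinh t ^ 2)) (s₀ := t)
    ((eventually_gt_nhds ht).mono fun s hs => hasDerivAt_coth hs)
    ((eventually_gt_nhds ht).mono fun s hs => hasDerivAt_div_sinh x hs)
    ((continuousAt_const.div (hsc.pow 2) (pow_ne_zero 2 hs.ne')).neg)
    (((continuousAt_const.mul hcc).div (hsc.pow 2) (pow_ne_zero 2 hs.ne')).neg) ha
  refine ((hasDerivAt_mehlerWeight_time x ht).smul h).congr_deriv ?_
  simp only [mehlerMoment, smul_smul, smul_add, neg_smul, smul_neg, neg_div,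
    neg_neg]
  rw [show mehlerWeight t x * (1 / Real.sinh t ^ 2 / 2) =
      1 / (2 * Real.sinh t ^ 2) * mehlerWeight t x by field_simp,
    mul_comm (mehlerWeight t x) (x * Real.cosh t / Real.sinh t ^ 2)]
  abel

theorem continuous_mehlerMoment_space (e : ℝ →ᵇ 𝕜) (n : ℕ) {t : ℝ} (ht : 0 < t) :
    Continuous (mehlerMoment e n t) :=
  continuous_iff_continuousAt.2 fun x => (hasDerivAt_mehlerMoment_space e n ht x).continuousAt

/-- The second space derivative of the Mehler evolution. -/
noncomputable def mehlerLaplacian (e : ℝ →ᵇ 𝕜) (t x : ℝ) : 𝕜 :=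
  (1 / Real.sinh t ^ 2) • mehlerMoment e 2 t x -
    (2 * (Real.cosh t / Real.sinh t ^ 2) * x) • mehlerMoment e 1 t x +
    ((Real.cosh t / Real.sinh t) ^ 2 * x ^ 2 - Real.cosh t / Real.sinh t) • mehlerMoment e 0 t x

theorem hasDerivAt_deriv_mehlerMoment (e : ℝ →ᵇ 𝕜) {t : ℝ} (ht : 0 < t) (x : ℝ) :
    HasDerivAt (fun x => -(Real.cosh t / Real.sinh t * x) • mehlerMoment e 0 t x +
        (1 / Real.sinh t) • mehlerMoment e 1 t x) (mehlerLaplacian e t x) x := by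
  have h0 := hasDerivAt_mehlerMoment_space e 0 ht x
  have h1 := hasDerivAt_mehlerMoment_space e 1 ht x
  have hl : HasDerivAt (fun x => -(Real.cosh t / Real.sinh t * x)) (-(Real.cosh t / Real.sinh t))
      x := by
    simpa using ((hasDerivAt_id x).const_mul (Real.cosh t / Real.sinh t)).fun_neg
  refine ((hl.smul h0).add (h1.const_smul (1 / Real.sinh t))).congr_deriv ?_
  simp only [mehlerLaplacian, zero_add, Nat.reduceAdd]
  module

/-- The Mehler evolution solves the evolution equation of the harmonic oscillator on the line. -/
theorem hasDerivAt_mehlerMoment_harmonic (e : ℝ →ᵇ 𝕜) {t : ℝ} (ht : 0 < t) (x : ℝ) :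
    HasDerivAt (fun t => mehlerMoment e 0 t x)
      (1 / 2 * (mehlerLaplacian e t x - (x : 𝕜) ^ 2 * mehlerMoment e 0 t x +
        mehlerMoment e 0 t x)) t := by
  have hs : 0 < Real.sinh t := Real.sinh_pos_iff.2 ht
  refine (hasDerivAt_mehlerMoment_time e 0 ht x).congr_deriv ?_
  have hx : (x : 𝕜) ^ 2 * mehlerMoment e 0 t x = (x ^ 2) • mehlerMoment e 0 t x := by
    rw [RCLike.real_smul_eq_coe_mul]
    push_cast
    rfl
  have h2 : ∀ z : 𝕜, 1 / 2 * z = (1 / 2 : ℝ) • z := fun z => by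
    rw [RCLike.real_smul_eq_coe_mul]
    push_cast
    rfl
  rw [hx, h2, mehlerLaplacian]
  simp only [zero_add]
  -- The `1` cancels the potential `x²`, and `1 / sinh²` matches the time derivative of the weight.
  have hc : (Real.cosh t / Real.sinh t) ^ 2 = 1 + 1 / Real.sinh t ^ 2 := by
    rw [div_pow, Real.cosh_sq]
    field_simp
  rw [hc]
  match_scalars <;> field_simp
  ring

theorem continuousAt_mehlerMoment_time (e : ℝ →ᵇ 𝕜) (n : ℕ) {t : ℝ} (ht : 0 < t) (x : ℝ) :
    ContinuousAt (fun t => mehlerMoment e n t x) t :=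
  (hasDerivAt_mehlerMoment_time e n ht x).continuousAt

theorem continuous_mehlerLaplacian (e : ℝ →ᵇ 𝕜) {t : ℝ} (ht : 0 < t) :
    Continuous (mehlerLaplacian e t) := by
  have h0 := continuous_mehlerMoment_space e 0 ht
  have h1 := continuous_mehlerMoment_space e 1 ht
  have h2 := continuous_mehlerMoment_space e 2 ht
  unfold mehlerLaplacian
  fun_prop

theorem continuousAt_mehlerLaplacian_time (e : ℝ →ᵇ 𝕜) {t : ℝ} (ht : 0 < t) (x : ℝ) :
    ContinuousAt (fun t => mehlerLaplacian e t x) t := by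
  have hs : Real.sinh t ≠ 0 := (Real.sinh_pos_iff.2 ht).ne'
  have hs2 : Real.sinh t ^ 2 ≠ 0 := pow_ne_zero 2 hs
  have h0 := continuousAt_mehlerMoment_time e 0 ht x
  have h1 := continuousAt_mehlerMoment_time e 1 ht x
  have h2 := continuousAt_mehlerMoment_time e 2 ht x
  have hsc := Real.continuous_sinh.continuousAt (x := t)
  have hcc := Real.continuous_cosh.continuousAt (x := t)
  have hq := hcc.div hsc hs
  exact (((continuousAt_const.div (hsc.pow 2) hs2).smul h2).sub
    (((continuousAt_const.mul (hcc.div (hsc.pow 2) hs2)).mul continuousAt_const).smul h1)).add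
    ((((hq.pow 2).mul continuousAt_const).sub hq).smul h0)

theorem abs_pow_mul_exp_neg_mul_sq_le (k : ℕ) {c : ℝ} (hc : 0 < c) (x : ℝ) :
    |x| ^ k * Real.exp (-c * x ^ 2) ≤ k.factorial * Real.exp (1 / (4 * c)) := by
  have h1 : |x| ^ k ≤ k.factorial * Real.exp |x| := by
    have := Real.pow_div_factorial_le_exp |x| (abs_nonneg x) k
    rwa [div_le_iff₀ (by positivity), mul_comm] at this
  calc |x| ^ k * Real.exp (-c * x ^ 2) ≤ k.factorial * Real.exp |x| * Real.exp (-c * x ^ 2) := by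
        gcongr
    _ = k.factorial * Real.exp (|x| + -c * x ^ 2) := by rw [mul_assoc, ← Real.exp_add]
    _ ≤ k.factorial * Real.exp (1 / (4 * c)) := by
        gcongr
        have : 1 / (4 * c) - (|x| + -c * x ^ 2) = (2 * c * |x| - 1) ^ 2 / (4 * c) := by
          rw [← sq_abs x]
          field_simp
          ring
        have h : 0 ≤ (2 * c * |x| - 1) ^ 2 / (4 * c) := by positivity
        linarith

/-- At a fixed positive time, the Mehler moments decay faster than any power. -/
theorem exists_bound_mehlerMoment (e : ℝ →ᵇ 𝕜) (n k : ℕ) {t : ℝ} (ht : 0 < t) :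
    ∃ C, ∀ x : ℝ, |x| ^ k * ‖mehlerMoment e n t x‖ ≤ C := by
  have hs : 0 < Real.sinh t := Real.sinh_pos_iff.2 ht
  -- Writing `2xy = x² + y² - (x - y)²`, the kernel exponent is `-c (x² + y²) - (x - y)² / (2 sinh
  -- t)`.
  set c := (Real.cosh t - 1) / (2 * Real.sinh t) with hcdef
  have hc : 0 < c := div_pos (sub_pos.2 (Real.one_lt_cosh.2 ht.ne')) (by positivity)
  set r := √(Real.exp t / (2 * Real.pi * Real.sinh t)) with hr
  set I := ∫ y : ℝ, |y| ^ n * Real.exp (-c * y ^ 2) with hI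
  have hI0 : 0 ≤ I := integral_nonneg fun y => by positivity
  refine ⟨r * (I * ‖e‖) * (k.factorial * Real.exp (1 / (4 * c))), fun x => ?_⟩
  have hbound : ‖mehlerMoment e n t x‖ ≤ r * (I * ‖e‖) * Real.exp (-c * x ^ 2) := by
    have hi := (integrable_abs_pow_mul_exp_neg_mul_sq n hc).mul_const ‖e‖
    rw [mehlerMoment, gaussMoment, mehlerWeight, ← integral_smul]
    refine (norm_integral_le_of_norm_le
      (hi.const_mul (r * Real.exp (-c * x ^ 2))) (Eventually.of_forall fun y => ?_)).trans
      (le_of_eq ?_)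
    · rw [smul_smul, norm_smul, ← hr]
      have e1 : ‖r * Real.exp (-(Real.cosh t / Real.sinh t) * x ^ 2 / 2) *
          (y ^ n * Real.exp (-(Real.cosh t / Real.sinh t) * y ^ 2 / 2 + x / Real.sinh t * y))‖ =
          r * |y| ^ n * Real.exp (-(Real.cosh t / Real.sinh t) * x ^ 2 / 2 +
            (-(Real.cosh t / Real.sinh t) * y ^ 2 / 2 + x / Real.sinh t * y)) := by
        rw [Real.exp_add (_ / 2) (_ + _), norm_mul, norm_mul, norm_mul, norm_pow, Real.norm_eq_abs,
          Real.norm_eq_abs, Real.norm_eq_abs, Real.norm_eq_abs, Real.abs_exp, Real.abs_exp,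
          abs_of_nonneg (Real.sqrt_nonneg _)]
        ring
      rw [e1]
      have e2 : -(Real.cosh t / Real.sinh t) * x ^ 2 / 2 +
            (-(Real.cosh t / Real.sinh t) * y ^ 2 / 2 + x / Real.sinh t * y) ≤
          -c * x ^ 2 + -c * y ^ 2 := by
        have : -c * x ^ 2 + -c * y ^ 2 - (-(Real.cosh t / Real.sinh t) * x ^ 2 / 2 +
            (-(Real.cosh t / Real.sinh t) * y ^ 2 / 2 + x / Real.sinh t * y)) =
            (x - y) ^ 2 / (2 * Real.sinh t) := by
          rw [hcdef]
          field_simp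
          ring
        have h : 0 ≤ (x - y) ^ 2 / (2 * Real.sinh t) := by positivity
        linarith
      calc r * |y| ^ n * Real.exp (-(Real.cosh t / Real.sinh t) * x ^ 2 / 2 +
            (-(Real.cosh t / Real.sinh t) * y ^ 2 / 2 + x / Real.sinh t * y)) * ‖e y‖
          ≤ r * |y| ^ n * Real.exp (-c * x ^ 2 + -c * y ^ 2) * ‖e‖ := by
            gcongr
            exact e.norm_coe_le_norm y
        _ = r * Real.exp (-c * x ^ 2) * (|y| ^ n * Real.exp (-c * y ^ 2) * ‖e‖) := by
            rw [Real.exp_add]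
            ring
    · rw [integral_const_mul, integral_mul_const]
      ring
  calc |x| ^ k * ‖mehlerMoment e n t x‖
      ≤ |x| ^ k * (r * (I * ‖e‖) * Real.exp (-c * x ^ 2)) := by gcongr
    _ = r * (I * ‖e‖) * (|x| ^ k * Real.exp (-c * x ^ 2)) := by ring
    _ ≤ _ := mul_le_mul_of_nonneg_left (abs_pow_mul_exp_neg_mul_sq_le k hc x) (by positivity)

end MehlerMoments

/-! ### The Mehler evolution up to time zero -/

section MehlerAverage

open Filter Topology

variable {𝕜 : Type*} [RCLike 𝕜]

theorem integrable_exp_neg_sq_div_two : Integrable fun w : ℝ => Real.exp (-w ^ 2 / 2) := by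
  refine (integrable_exp_neg_mul_sq (b := 1 / 2) (by norm_num)).congr
    (Eventually.of_forall fun w => ?_)
  simp only
  congr 1
  ring

theorem integral_exp_neg_sq_div_two : ∫ w : ℝ, Real.exp (-w ^ 2 / 2) = √(2 * Real.pi) := by
  have h := integral_gaussian (1 / 2)
  rw [show Real.pi / (1 / 2) = 2 * Real.pi by ring] at h
  rw [← h]
  refine integral_congr_ae (Eventually.of_forall fun w => ?_)
  simp only
  congr 1
  ring

/-- The Mehler evolution, written as an average over a standard Gaussian variable. -/
noncomputable def mehlerAverage (e : ℝ →ᵇ 𝕜) (t x : ℝ) : 𝕜 :=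
  (√(Real.exp t / (2 * Real.pi * Real.cosh t)) * Real.exp (-Real.tanh t * x ^ 2 / 2)) •
    ∫ w : ℝ, Real.exp (-w ^ 2 / 2) • e (x / Real.cosh t + √(Real.tanh t) * w)

theorem integrable_mehlerAverage (e : ℝ →ᵇ 𝕜) (a b : ℝ) :
    Integrable fun w : ℝ => Real.exp (-w ^ 2 / 2) • e (a + b * w) := by
  refine (integrable_exp_neg_sq_div_two.mul_const ‖e‖).mono'
    (by have := e.continuous; fun_prop) (Eventually.of_forall fun w => ?_)
  rw [norm_smul, Real.norm_eq_abs, Real.abs_exp]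
  exact mul_le_mul_of_nonneg_left (e.norm_coe_le_norm _) (Real.exp_pos _).le

/-- The Gaussian weight does not depend on the parameters, so it serves as the dominating function,
also at `t = 0`. Negative times cause no trouble: there `√(tanh t)` is `0` by convention, which is
continuous. -/
theorem continuous_mehlerAverage (e : ℝ →ᵇ 𝕜) :
    Continuous fun p : ℝ × ℝ => mehlerAverage e p.1 p.2 := by
  have hcosh : Continuous fun p : ℝ × ℝ => Real.cosh p.1 := by fun_prop
  have hcn : ∀ p : ℝ × ℝ, Real.cosh p.1 ≠ 0 := fun p => (Real.cosh_pos _).ne'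
  have htanh : Continuous fun p : ℝ × ℝ => Real.tanh p.1 := by
    simp only [Real.tanh_eq_sinh_div_cosh]
    exact (by fun_prop : Continuous fun p : ℝ × ℝ => Real.sinh p.1).div hcosh hcn
  refine Continuous.smul (Continuous.mul ?_ (by fun_prop)) ?_
  · refine Real.continuous_sqrt.comp (Continuous.div (by fun_prop) (by fun_prop) fun p => ?_)
    exact mul_ne_zero (by positivity) (hcn p)
  · refine continuous_of_dominated (bound := fun w => Real.exp (-w ^ 2 / 2) * ‖e‖)
      (fun p => (integrable_mehlerAverage e _ _).aestronglyMeasurable)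
      (fun p => Eventually.of_forall fun w => ?_)
      (integrable_exp_neg_sq_div_two.mul_const _) (Eventually.of_forall fun w => ?_)
    · rw [norm_smul, Real.norm_eq_abs, Real.abs_exp]
      exact mul_le_mul_of_nonneg_left (e.norm_coe_le_norm _) (Real.exp_pos _).le
    · refine continuous_const.smul (e.continuous.comp ?_)
      exact (continuous_snd.div hcosh hcn).add
        ((Real.continuous_sqrt.comp htanh).mul continuous_const)

theorem mehlerAverage_zero (e : ℝ →ᵇ 𝕜) (x : ℝ) : mehlerAverage e 0 x = e x := by
  simp only [mehlerAverage, Real.exp_zero, Real.cosh_zero, mul_one, Real.tanh_zero, neg_zero,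
    zero_mul, zero_div, Real.sqrt_zero, add_zero, div_one]
  rw [integral_smul_const, integral_exp_neg_sq_div_two, smul_smul, ← Real.sqrt_mul (by positivity),
    one_div_mul_cancel (by positivity), Real.sqrt_one, one_smul]

theorem norm_mehlerAverage_le (e : ℝ →ᵇ 𝕜) {t : ℝ} (ht : 0 ≤ t) (x : ℝ) :
    ‖mehlerAverage e t x‖ ≤ 2 * ‖e‖ := by
  have hc := Real.cosh_pos t
  have h1 : ‖∫ w : ℝ, Real.exp (-w ^ 2 / 2) • e (x / Real.cosh t + √(Real.tanh t) * w)‖ ≤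
      √(2 * Real.pi) * ‖e‖ := by
    rw [← integral_exp_neg_sq_div_two, ← integral_mul_const]
    refine norm_integral_le_of_norm_le (integrable_exp_neg_sq_div_two.mul_const _)
      (Eventually.of_forall fun w => ?_)
    rw [norm_smul, Real.norm_eq_abs, Real.abs_exp]
    exact mul_le_mul_of_nonneg_left (e.norm_coe_le_norm _) (Real.exp_pos _).le
  have h2 : Real.exp (-Real.tanh t * x ^ 2 / 2) ≤ 1 := by
    have : 0 ≤ Real.tanh t := by
      rw [Real.tanh_eq_sinh_div_cosh]
      exact div_nonneg (Real.sinh_nonneg_iff.2 ht) hc.le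
    rw [Real.exp_le_one_iff]
    have := mul_nonneg this (sq_nonneg x)
    linarith
  have h3 : √(Real.exp t / (2 * Real.pi * Real.cosh t)) * √(2 * Real.pi) ≤ 2 := by
    rw [← Real.sqrt_mul (by positivity)]
    refine Real.sqrt_le_iff.2 ⟨by norm_num, ?_⟩
    rw [show Real.exp t / (2 * Real.pi * Real.cosh t) * (2 * Real.pi) = Real.exp t / Real.cosh t by
      field_simp, div_le_iff₀ hc, Real.cosh_eq]
    linarith [Real.exp_pos t, Real.exp_pos (-t)]
  rw [mehlerAverage, norm_smul, norm_mul, Real.norm_eq_abs, Real.norm_eq_abs, Real.abs_exp,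
    abs_of_nonneg (Real.sqrt_nonneg _)]
  calc √(Real.exp t / (2 * Real.pi * Real.cosh t)) * Real.exp (-Real.tanh t * x ^ 2 / 2) *
        ‖∫ w : ℝ, Real.exp (-w ^ 2 / 2) • e (x / Real.cosh t + √(Real.tanh t) * w)‖
      ≤ √(Real.exp t / (2 * Real.pi * Real.cosh t)) * 1 * (√(2 * Real.pi) * ‖e‖) := by gcongr
    _ = √(Real.exp t / (2 * Real.pi * Real.cosh t)) * √(2 * Real.pi) * ‖e‖ := by ring
    _ ≤ 2 * ‖e‖ := by gcongr

theorem mehlerAverage_add (e e' : ℝ →ᵇ 𝕜) (t x : ℝ) :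
    mehlerAverage (e + e') t x = mehlerAverage e t x + mehlerAverage e' t x := by
  simp only [mehlerAverage, BoundedContinuousFunction.coe_add, Pi.add_apply, smul_add]
  rw [integral_add (integrable_mehlerAverage e _ _) (integrable_mehlerAverage e' _ _), smul_add]

theorem mehlerAverage_smul (c : 𝕜) (e : ℝ →ᵇ 𝕜) (t x : ℝ) :
    mehlerAverage (c • e) t x = c • mehlerAverage e t x := by
  simp only [mehlerAverage, BoundedContinuousFunction.coe_smul, smul_comm _ c]
  rw [integral_smul]
  simp only [smul_comm _ c]

/-- For positive times the Gaussian average is the integral against the Mehler kernel. -/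
theorem mehlerAverage_eq_mehlerMoment (e : ℝ →ᵇ 𝕜) {t : ℝ} (ht : 0 < t) (x : ℝ) :
    mehlerAverage e t x = mehlerMoment e 0 t x := by
  have hs : 0 < Real.sinh t := Real.sinh_pos_iff.2 ht
  have hc := Real.cosh_pos t
  have hth : 0 < Real.tanh t := by
    rw [Real.tanh_eq_sinh_div_cosh]
    exact div_pos hs hc
  have hτ : 0 < √(Real.tanh t) := Real.sqrt_pos.2 hth
  have hτ2 : √(Real.tanh t) ^ 2 = Real.sinh t / Real.cosh t := by
    rw [Real.sq_sqrt hth.le, Real.tanh_eq_sinh_div_cosh]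
  -- Substitution `y = x / cosh t + √(tanh t) w`.
  have h1 : ∫ w : ℝ, Real.exp (-w ^ 2 / 2) • e (x / Real.cosh t + √(Real.tanh t) * w) =
      (√(Real.tanh t))⁻¹ • ∫ y : ℝ,
        Real.exp (-((y - x / Real.cosh t) / √(Real.tanh t)) ^ 2 / 2) • e y := by
    rw [← integral_add_right_eq_self (fun y : ℝ =>
      Real.exp (-((y - x / Real.cosh t) / √(Real.tanh t)) ^ 2 / 2) • e y) (x / Real.cosh t),
      ← abs_of_pos (inv_pos.2 hτ), ← Measure.integral_comp_mul_left]
    refine integral_congr_ae (Eventually.of_forall fun w => ?_)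
    simp only [add_sub_cancel_right]
    rw [mul_div_cancel_left₀ _ hτ.ne', add_comm]
  rw [mehlerAverage, h1, mehlerMoment, gaussMoment, smul_smul, ← integral_smul, ← integral_smul]
  refine integral_congr_ae (Eventually.of_forall fun y => ?_)
  simp only [smul_smul, mehlerWeight, pow_zero, one_mul]
  congr 1
  have h2 : √(Real.exp t / (2 * Real.pi * Real.sinh t)) =
      √(Real.exp t / (2 * Real.pi * Real.cosh t)) * (√(Real.tanh t))⁻¹ := by
    rw [← Real.sqrt_inv, ← Real.sqrt_mul (by positivity), Real.tanh_eq_sinh_div_cosh]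
    congr 1
    field_simp
  rw [h2, mul_assoc (_ * _) (Real.exp _) (Real.exp _), ← Real.exp_add,
    mul_right_comm (√(Real.exp t / (2 * Real.pi * Real.cosh t))), mul_assoc (_ * _) (Real.exp _)
    (Real.exp _), ← Real.exp_add]
  congr 2
  rw [div_pow, hτ2, Real.tanh_eq_sinh_div_cosh]
  have hcs := Real.cosh_sq t
  field_simp
  linear_combination x ^ 2 * hcs

end MehlerAverage

/-! ### Functions on the star graph and their extensions to the line -/

section Star

open Filter Topology

variable {𝕜 : Type*} [RCLike 𝕜] {m : ℕ}

namespace StarGraph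

/-- The distance to the vertex on the `i`-th ray, extended by zero to the other rays. -/
def coord (i : Fin m) : StarGraph m → ℝ≥0 :=
  Quotient.lift (fun p : Fin m × ℝ≥0 => if p.1 = i then p.2 else 0) (by
    rintro p q (rfl | ⟨h, h'⟩)
    · rfl
    · simp only [h, h', ite_self])

theorem coord_pt (i j : Fin m) (x : ℝ≥0) : coord i (pt j x) = if j = i then x else 0 := rfl

theorem continuous_coord (i : Fin m) : Continuous (coord i) := by
  refine Continuous.quotient_lift (continuous_prod_of_discrete_left.2 fun j => ?_) _
  by_cases h : j = i
  · simp only [h, if_true]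
    exact continuous_id
  · simp only [h, if_false]
    exact continuous_const

/-- The function on the star graph with given components. -/
noncomputable def glue [NeZero m] (H : Fin m → ℝ → 𝕜) (p : StarGraph m) : 𝕜 :=
  -- At a point of one ray all other coordinates are zero, so only the summand of that ray survives.
  H 0 0 + ∑ i, (H i (coord i p) - H i 0)

theorem glue_pt [NeZero m] {H : Fin m → ℝ → 𝕜} (h0 : ∀ i j, H i 0 = H j 0) (i : Fin m)
    (x : ℝ≥0) : glue H (pt i x) = H i x := by
  rw [glue, Finset.sum_eq_single i]
  · rw [coord_pt, if_pos rfl, h0 0 i, add_sub_cancel]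
  · intro j _ hj
    rw [coord_pt, if_neg hj.symm, NNReal.coe_zero, sub_self]
  · exact fun h => absurd (Finset.mem_univ i) h

theorem exists_bcf_of_components [NeZero m] (H : Fin m → ℝ → 𝕜) (hc : ∀ i, Continuous (H i))
    (h0 : ∀ i j, H i 0 = H j 0) (hb : ∀ i, ∃ C, ∀ x, ‖H i x‖ ≤ C) :
    ∃ g : StarGraph m →ᵇ 𝕜, ∀ i (x : ℝ≥0), g (pt i x) = H i x := by
  choose C hC using hb
  have hC0 : ∀ i, 0 ≤ C i := fun i => (norm_nonneg _).trans (hC i 0)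
  have hcont : Continuous (glue H) := by
    refine continuous_const.add (continuous_finsetSum _ fun i _ => Continuous.sub ?_ ?_)
    · exact (hc i).comp (NNReal.continuous_coe.comp (continuous_coord i))
    · exact continuous_const
  refine ⟨BoundedContinuousFunction.ofNormedAddCommGroup (glue H) hcont (∑ i, C i) fun p => ?_,
    fun i x => glue_pt h0 i x⟩
  obtain ⟨i, x, rfl⟩ := p.exists_eq_pt
  rw [glue_pt h0]
  exact (hC i x).trans (Finset.single_le_sum (fun j _ => hC0 j) (Finset.mem_univ i))

theorem onRay_coe {E : Type*} (f : StarGraph m → E) (i : Fin m) (x : ℝ≥0) :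
    onRay f i x = f (pt i x) := by
  rw [onRay, Real.toNNReal_coe]

theorem onRay_of_nonpos {E : Type*} (f : StarGraph m → E) (i j : Fin m) {x : ℝ} (hx : x ≤ 0) :
    onRay f i x = onRay f j 0 := by
  rw [onRay, onRay, Real.toNNReal_of_nonpos hx, Real.toNNReal_zero, pt_zero_eq i j]

end StarGraph

open StarGraph

theorem norm_onRay_le (f : StarGraph m →ᵇ 𝕜) (i : Fin m) (x : ℝ) : ‖onRay f i x‖ ≤ ‖f‖ :=
  f.norm_coe_le_norm _

/-- The extension of the `i`-th component to the line that turns the vertex conditions into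
smoothness: on the negative half-line it is twice the mean of all components minus the `i`-th one,
reflected. -/
noncomputable def reflectExt (f : StarGraph m →ᵇ 𝕜) (i : Fin m) : ℝ →ᵇ 𝕜 :=
  BoundedContinuousFunction.ofNormedAddCommGroup
    -- `onRay` takes the vertex value at all negative arguments, so one formula serves both
    -- half-lines: for `y ≥ 0` the last three terms cancel.
    (fun y => onRay f i y + (2 / (m : ℝ)) • ∑ j, onRay f j (-y) - onRay f i (-y) - onRay f i 0)
    (by
      have h : ∀ j, Continuous (onRay f j) := fun j => continuous_onRay f.continuous j
      have h' : ∀ j, Continuous fun y => onRay f j (-y) := fun j => (h j).comp continuous_neg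
      fun_prop)
    (5 * ‖f‖) (fun y => by
      have hm : (0 : ℝ) < m := Nat.cast_pos.2 i.pos
      have h1 : ‖(2 / (m : ℝ)) • ∑ j, onRay f j (-y)‖ ≤ 2 * ‖f‖ := by
        rw [norm_smul, Real.norm_of_nonneg (by positivity)]
        calc 2 / (m : ℝ) * ‖∑ j, onRay f j (-y)‖ ≤ 2 / (m : ℝ) * (m * ‖f‖) := by
              gcongr
              refine (norm_sum_le_of_le _ fun j _ => norm_onRay_le f j (-y)).trans ?_
              simp
          _ = 2 * ‖f‖ := by field_simp
      have h2 := norm_sub_le (onRay f i y + (2 / (m : ℝ)) • ∑ j, onRay f j (-y) - onRay f i (-y))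
        (onRay f i 0)
      have h3 := norm_sub_le (onRay f i y + (2 / (m : ℝ)) • ∑ j, onRay f j (-y)) (onRay f i (-y))
      have h4 := norm_add_le (onRay f i y) ((2 / (m : ℝ)) • ∑ j, onRay f j (-y))
      linarith [norm_onRay_le f i y, norm_onRay_le f i (-y), norm_onRay_le f i 0])

theorem reflectExt_apply (f : StarGraph m →ᵇ 𝕜) (i : Fin m) (y : ℝ) :
    reflectExt f i y = onRay f i y + (2 / (m : ℝ)) • ∑ j, onRay f j (-y) - onRay f i (-y) -
      onRay f i 0 := rfl

theorem norm_reflectExt_le (f : StarGraph m →ᵇ 𝕜) (i : Fin m) : ‖reflectExt f i‖ ≤ 5 * ‖f‖ :=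
  BoundedContinuousFunction.norm_ofNormedAddCommGroup_le _ (by positivity) _

theorem reflectExt_add (f g : StarGraph m →ᵇ 𝕜) (i : Fin m) :
    reflectExt (f + g) i = reflectExt f i + reflectExt g i := by
  ext y
  simp only [BoundedContinuousFunction.coe_add, Pi.add_apply, reflectExt_apply, onRay,
    Finset.sum_add_distrib, smul_add]
  ring

theorem reflectExt_smul (c : 𝕜) (f : StarGraph m →ᵇ 𝕜) (i : Fin m) :
    reflectExt (c • f) i = c • reflectExt f i := by
  ext y
  simp only [BoundedContinuousFunction.coe_smul, reflectExt_apply, onRay, ← Finset.smul_sum,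
    smul_comm _ c, smul_sub, smul_add]

theorem two_div_smul_sum_const {z : 𝕜} (i : Fin m) : (2 / (m : ℝ)) • ∑ _j : Fin m, z = z + z := by
  have hm : (m : ℝ) ≠ 0 := (Nat.cast_pos.2 i.pos).ne'
  rw [Finset.sum_const, Finset.card_univ, Fintype.card_fin, ← Nat.cast_smul_eq_nsmul ℝ, smul_smul,
    div_mul_cancel₀ _ hm, two_smul]

theorem reflectExt_of_nonneg (f : StarGraph m →ᵇ 𝕜) (i : Fin m) {y : ℝ} (hy : 0 ≤ y) :
    reflectExt f i y = onRay f i y := by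
  have h : ∀ j, onRay f j (-y) = onRay f i 0 := fun j => onRay_of_nonpos f j i (neg_nonpos.2 hy)
  rw [reflectExt_apply, h i, Finset.sum_congr rfl fun j _ => h j, two_div_smul_sum_const i]
  ring

theorem reflectExt_neg (f : StarGraph m →ᵇ 𝕜) (i : Fin m) {y : ℝ} (hy : 0 ≤ y) :
    reflectExt f i (-y) = (2 / (m : ℝ)) • ∑ j, onRay f j y - onRay f i y := by
  rw [reflectExt_apply, neg_neg, onRay_of_nonpos f i i (neg_nonpos.2 hy)]
  ring

theorem reflectExt_sub_odd (f : StarGraph m →ᵇ 𝕜) (i j : Fin m) (y : ℝ) :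
    reflectExt f i (-y) - reflectExt f j (-y) = -(reflectExt f i y - reflectExt f j y) := by
  simp only [reflectExt_apply, neg_neg, onRay_of_nonpos f i j le_rfl]
  ring

/-- Summing the mean over `i` gives `2 ∑ f_j(-y)`, one copy of which is cancelled; what remains is
symmetric in `y` and `-y`. -/
theorem sum_reflectExt_even (f : StarGraph m →ᵇ 𝕜) (y : ℝ) :
    ∑ i, reflectExt f i (-y) = ∑ i, reflectExt f i y := by
  rcases Nat.eq_zero_or_pos m with rfl | hm
  · simp
  have key : ∀ y, ∑ i, reflectExt f i y =
      ∑ i, onRay f i y + ∑ i, onRay f i (-y) - ∑ i, onRay f i 0 := by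
    intro y
    have h := (Finset.smul_sum (r := (2 / (m : ℝ)))
      (f := fun _ : Fin m => ∑ j, onRay f j (-y)) (s := Finset.univ)).symm.trans
      (two_div_smul_sum_const ⟨0, hm⟩)
    simp only [reflectExt_apply, Finset.sum_sub_distrib, Finset.sum_add_distrib]
    rw [h]
    ring
  rw [key, key, neg_neg]
  ring

theorem integral_eq_zero_of_odd {F : ℝ → 𝕜} (h : ∀ y, F (-y) = -F y) : ∫ y, F y = 0 := by
  have h1 := integral_neg_eq_self F (volume : Measure ℝ)
  simp only [h, integral_neg] at h1
  exact self_eq_neg.1 h1.symm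

theorem gaussMoment_reflectExt_vertex (f : StarGraph m →ᵇ 𝕜) (i j : Fin m) {n : ℕ} (hn : Even n)
    {p : ℝ} (hp : 0 < p) :
    gaussMoment (reflectExt f i) n p 0 = gaussMoment (reflectExt f j) n p 0 := by
  rw [← sub_eq_zero, gaussMoment, gaussMoment, ← integral_sub (integrable_gaussMoment _ n hp 0)
    (integrable_gaussMoment _ n hp 0)]
  refine integral_eq_zero_of_odd fun y => ?_
  rw [← smul_sub, ← smul_sub, reflectExt_sub_odd, hn.neg_pow, smul_neg, zero_mul, zero_mul, neg_sq]

theorem sum_gaussMoment_reflectExt_one (f : StarGraph m →ᵇ 𝕜) {p : ℝ} (hp : 0 < p) :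
    ∑ i, gaussMoment (reflectExt f i) 1 p 0 = 0 := by
  simp only [gaussMoment]
  rw [← integral_finsetSum _ fun i _ => integrable_gaussMoment _ 1 hp 0]
  refine integral_eq_zero_of_odd fun y => ?_
  rw [← Finset.smul_sum, ← Finset.smul_sum, sum_reflectExt_even, pow_one, pow_one, neg_sq,
    zero_mul, zero_mul, neg_mul, neg_smul]

theorem mehlerMoment_reflectExt_vertex (f : StarGraph m →ᵇ 𝕜) (i j : Fin m) {n : ℕ} (hn : Even n)
    {t : ℝ} (ht : 0 < t) :
    mehlerMoment (reflectExt f i) n t 0 = mehlerMoment (reflectExt f j) n t 0 := by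
  rw [mehlerMoment, mehlerMoment, zero_div, gaussMoment_reflectExt_vertex f i j hn
    (div_pos (Real.cosh_pos t) (Real.sinh_pos_iff.2 ht))]

theorem mehlerAverage_reflectExt_vertex (f : StarGraph m →ᵇ 𝕜) (i j : Fin m) {t : ℝ}
    (ht : 0 ≤ t) :
    mehlerAverage (reflectExt f i) t 0 = mehlerAverage (reflectExt f j) t 0 := by
  rcases ht.eq_or_lt with rfl | ht
  · rw [mehlerAverage_zero, mehlerAverage_zero, reflectExt_of_nonneg f i le_rfl,
      reflectExt_of_nonneg f j le_rfl, onRay_of_nonpos f i j le_rfl]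
  · rw [mehlerAverage_eq_mehlerMoment _ ht, mehlerAverage_eq_mehlerMoment _ ht,
      mehlerMoment_reflectExt_vertex f i j Even.zero ht]

/-! ### The explicit formula -/

theorem integrableOn_exp_smul_onRay (f : StarGraph m →ᵇ 𝕜) (i : Fin m) {p : ℝ} (hp : 0 < p)
    (q : ℝ) : IntegrableOn (fun y => Real.exp (-p * y ^ 2 / 2 + q * y) • onRay f i y) (Ioi 0) := by
  refine ((integrable_gaussMoment (reflectExt f i) 0 hp q).integrableOn (s := Ioi 0)).congr_fun
    (fun y hy => ?_) measurableSet_Ioi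
  simp only [pow_zero, one_mul, reflectExt_of_nonneg f i (le_of_lt hy)]

/-- Fold the negative half-line by `y ↦ -y`. The two `f_i` terms give the difference of exponentials
(later the `sinh`), and the mean gives the sum over all rays. -/
theorem gaussMoment_reflectExt (f : StarGraph m →ᵇ 𝕜) (i : Fin m) {p : ℝ} (hp : 0 < p) (q : ℝ) :
    gaussMoment (reflectExt f i) 0 p q =
      (∫ y in Ioi (0 : ℝ), (Real.exp (-p * y ^ 2 / 2 + q * y) -
        Real.exp (-p * y ^ 2 / 2 + -q * y)) • onRay f i y) +
      (2 / (m : ℝ)) • ∑ j, ∫ y in Ioi (0 : ℝ), Real.exp (-p * y ^ 2 / 2 + -q * y) • onRay f j y := by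
  have hi := integrable_gaussMoment (reflectExt f i) 0 hp q
  have h1 : ∫ y in Iic (0 : ℝ), (y ^ 0 * Real.exp (-p * y ^ 2 / 2 + q * y)) • reflectExt f i y =
      ∫ y in Ioi (0 : ℝ), Real.exp (-p * y ^ 2 / 2 + -q * y) •
        ((2 / (m : ℝ)) • ∑ j, onRay f j y - onRay f i y) := by
    rw [← neg_zero, ← integral_comp_neg_Ioi, neg_zero]
    refine setIntegral_congr_fun measurableSet_Ioi fun y hy => ?_
    simp only [reflectExt_neg f i (le_of_lt hy), pow_zero, one_mul, neg_sq, mul_neg, neg_mul]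
  have h2 : ∫ y in Ioi (0 : ℝ), (y ^ 0 * Real.exp (-p * y ^ 2 / 2 + q * y)) • reflectExt f i y =
      ∫ y in Ioi (0 : ℝ), Real.exp (-p * y ^ 2 / 2 + q * y) • onRay f i y :=
    setIntegral_congr_fun measurableSet_Ioi fun y hy => by
      simp only [reflectExt_of_nonneg f i (le_of_lt hy), pow_zero, one_mul]
  have ip := integrableOn_exp_smul_onRay f i hp q
  have im : ∀ j, IntegrableOn (fun y => Real.exp (-p * y ^ 2 / 2 + -q * y) • onRay f j y)
    (Ioi 0) := fun j => integrableOn_exp_smul_onRay f j hp (-q)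
  have is : IntegrableOn (fun y => (2 / (m : ℝ)) •
      ∑ j, Real.exp (-p * y ^ 2 / 2 + -q * y) • onRay f j y) (Ioi 0) :=
    (integrable_finsetSum Finset.univ fun j _ => im j).smul (2 / (m : ℝ))
  rw [gaussMoment, ← intervalIntegral.integral_Iic_add_Ioi hi.integrableOn hi.integrableOn
    (b := (0 : ℝ)), h1, h2]
  have e1 : ∀ y, Real.exp (-p * y ^ 2 / 2 + -q * y) •
      ((2 / (m : ℝ)) • ∑ j, onRay f j y - onRay f i y) =
      (2 / (m : ℝ)) • (∑ j, Real.exp (-p * y ^ 2 / 2 + -q * y) • onRay f j y) -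
        Real.exp (-p * y ^ 2 / 2 + -q * y) • onRay f i y := fun y => by
    rw [smul_sub, smul_comm, Finset.smul_sum]
  simp only [e1, sub_smul]
  rw [integral_sub is (im i), integral_sub ip (im i), integral_smul,
    integral_finsetSum _ fun j _ => im j]
  abel

theorem mehlerMoment_reflectExt_eq_mehlerStar (f : StarGraph m →ᵇ 𝕜) (i : Fin m) {t : ℝ}
    (ht : 0 < t) (x : ℝ) : mehlerMoment (reflectExt f i) 0 t x = mehlerStar t f i x := by
  have hm : (0 : ℝ) < m := Nat.cast_pos.2 i.pos
  have hs : 0 < Real.sinh t := Real.sinh_pos_iff.2 ht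
  have hπ := Real.pi_pos
  -- All hyperbolic functions are rewritten as rational functions of `e^{-t}`, which reduces the
  -- comparison of kernels to algebra.
  have hE2 : Real.exp (-2 * t) = Real.exp (-t) ^ 2 := by
    rw [← Real.exp_nat_mul]
    congr 1
    push_cast
    ring
  have hE0 := Real.exp_pos (-t)
  have hE1 : Real.exp (-t) < 1 := Real.exp_lt_one_iff.2 (by linarith)
  have hEt : Real.exp t = 1 / Real.exp (-t) := by rw [Real.exp_neg, one_div, inv_inv]
  have hsinh : Real.sinh t = (1 - Real.exp (-t) ^ 2) / (2 * Real.exp (-t)) := by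
    rw [Real.sinh_eq, hEt]
    field_simp
  have hcosh : Real.cosh t = (1 + Real.exp (-t) ^ 2) / (2 * Real.exp (-t)) := by
    rw [Real.cosh_eq, hEt]
    field_simp
  have hd : 0 < 1 - Real.exp (-t) ^ 2 := by nlinarith
  have hw : √(Real.exp t / (2 * Real.pi * Real.sinh t)) =
      1 / √(Real.pi * (1 - Real.exp (-2 * t))) := by
    rw [← Real.sqrt_one, ← Real.sqrt_div zero_le_one, Real.sqrt_one, hE2, hsinh, hEt]
    congr 1
    field_simp
  have hplus : ∀ y, Real.exp (-(Real.cosh t / Real.sinh t) * x ^ 2 / 2) *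
      Real.exp (-(Real.cosh t / Real.sinh t) * y ^ 2 / 2 + x / Real.sinh t * y) =
      Real.exp (-((1 + Real.exp (-2 * t)) * (x ^ 2 + y ^ 2) / (2 * (1 - Real.exp (-2 * t))))) *
        Real.exp (2 * x * y * Real.exp (-t) / (1 - Real.exp (-2 * t))) := fun y => by
    rw [← Real.exp_add, ← Real.exp_add, hsinh, hcosh, hE2]
    congr 1
    field_simp
    ring
  have hminus : ∀ y, Real.exp (-(Real.cosh t / Real.sinh t) * x ^ 2 / 2) *
      Real.exp (-(Real.cosh t / Real.sinh t) * y ^ 2 / 2 + -(x / Real.sinh t) * y) =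
      Real.exp (-((1 + Real.exp (-2 * t)) * (x ^ 2 + y ^ 2) / (2 * (1 - Real.exp (-2 * t))))) *
        Real.exp (-(2 * x * y * Real.exp (-t) / (1 - Real.exp (-2 * t)))) := fun y => by
    rw [← Real.exp_add, ← Real.exp_add, hsinh, hcosh, hE2]
    congr 1
    field_simp
    ring
  have hexp : ∀ y, Real.exp ((-4 * x * y * Real.exp (-t) -
        (x ^ 2 + y ^ 2) * (1 + Real.exp (-2 * t))) / (2 * (1 - Real.exp (-2 * t)))) =
      Real.exp (-((1 + Real.exp (-2 * t)) * (x ^ 2 + y ^ 2) / (2 * (1 - Real.exp (-2 * t))))) *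
        Real.exp (-(2 * x * y * Real.exp (-t) / (1 - Real.exp (-2 * t)))) := fun y => by
    rw [← Real.exp_add]
    congr 1
    rw [hE2]
    field_simp
    ring
  rw [mehlerMoment, gaussMoment_reflectExt f i (div_pos (Real.cosh_pos t) hs), smul_add, mehlerStar]
  congr 1
  · rw [← integral_smul, ← integral_smul]
    refine integral_congr_ae (Eventually.of_forall fun y => ?_)
    simp only [smul_smul, mehlerWeight]
    congr 1
    rw [hw, Real.sinh_eq (2 * x * y * Real.exp (-t) / (1 - Real.exp (-2 * t)))]
    linear_combination (1 / √(Real.pi * (1 - Real.exp (-2 * t)))) * (hplus y - hminus y)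
  · rw [smul_smul, Finset.smul_sum, Finset.smul_sum]
    refine Finset.sum_congr rfl fun j _ => ?_
    rw [← integral_smul, ← integral_smul]
    refine integral_congr_ae (Eventually.of_forall fun y => ?_)
    simp only [smul_smul, mehlerWeight]
    congr 1
    rw [hw, hexp y, show (2 : ℝ) / (m * √(Real.pi * (1 - Real.exp (-2 * t)))) =
      2 / m * (1 / √(Real.pi * (1 - Real.exp (-2 * t)))) by rw [div_mul_div_comm, mul_one]]
    linear_combination (2 / m * (1 / √(Real.pi * (1 - Real.exp (-2 * t))))) * hminus y

end Star

/-! ### The semigroup and the classical solution -/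

section Solution

open Filter Topology StarGraph

variable {𝕜 : Type*} [RCLike 𝕜] {m : ℕ} [NeZero m]

/-- The solution of the Cauchy problem for the harmonic oscillator on the star graph. -/
noncomputable def mehlerSolution (f : StarGraph m →ᵇ 𝕜) : (ℝ≥0 × StarGraph m) →ᵇ 𝕜 :=
  BoundedContinuousFunction.ofNormedAddCommGroup
    (fun p => glue (fun i x => mehlerAverage (reflectExt f i) p.1 x) p.2)
    (by
      unfold glue
      have h : ∀ i {g : ℝ≥0 × StarGraph m → ℝ}, Continuous g →
          Continuous fun p : ℝ≥0 × StarGraph m => mehlerAverage (reflectExt f i) p.1 (g p) :=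
        fun i g hg => (continuous_mehlerAverage (reflectExt f i)).comp
          ((NNReal.continuous_coe.comp continuous_fst).prodMk hg)
      refine (h 0 continuous_const).add (continuous_finsetSum _ fun i _ => Continuous.sub ?_ ?_)
      · exact h i (NNReal.continuous_coe.comp ((continuous_coord i).comp continuous_snd))
      · exact h i continuous_const)
    (10 * ‖f‖) (fun p => by
      obtain ⟨t, p⟩ := p
      obtain ⟨i, x, rfl⟩ := p.exists_eq_pt
      change ‖glue (fun i => mehlerAverage (reflectExt f i) t) (pt i x)‖ ≤ _
      rw [glue_pt fun i j => mehlerAverage_reflectExt_vertex f i j t.coe_nonneg]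
      refine (norm_mehlerAverage_le _ t.coe_nonneg _).trans ?_
      linarith [norm_reflectExt_le f i])

theorem mehlerSolution_pt (f : StarGraph m →ᵇ 𝕜) (t : ℝ≥0) (i : Fin m) (x : ℝ≥0) :
    mehlerSolution f (t, pt i x) = mehlerAverage (reflectExt f i) t x :=
  glue_pt (fun i j => mehlerAverage_reflectExt_vertex f i j t.coe_nonneg) i x

theorem norm_mehlerSolution_le (f : StarGraph m →ᵇ 𝕜) : ‖mehlerSolution f‖ ≤ 10 * ‖f‖ :=
  BoundedContinuousFunction.norm_ofNormedAddCommGroup_le _ (by positivity) _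

theorem mehlerSolution_pt_of_pos (f : StarGraph m →ᵇ 𝕜) {t : ℝ≥0} (ht : 0 < t) (i : Fin m)
    (x : ℝ≥0) : mehlerSolution f (t, pt i x) = mehlerMoment (reflectExt f i) 0 t x := by
  rw [mehlerSolution_pt, mehlerAverage_eq_mehlerMoment _ (NNReal.coe_pos.2 ht)]

theorem onRay_timeSlice_mehlerSolution (f : StarGraph m →ᵇ 𝕜) {t : ℝ≥0} (ht : 0 < t) (i : Fin m)
    {x : ℝ} (hx : 0 ≤ x) :
    onRay (timeSlice (mehlerSolution f) t) i x = mehlerMoment (reflectExt f i) 0 t x := by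
  have := mehlerSolution_pt_of_pos f ht i x.toNNReal
  rwa [Real.coe_toNNReal x hx] at this

theorem exists_bound_harmonic_mehlerMoment (e : ℝ →ᵇ 𝕜) {t : ℝ} (ht : 0 < t) :
    ∃ C, ∀ x : ℝ, ‖1 / 2 * (mehlerLaplacian e t x - (x : 𝕜) ^ 2 * mehlerMoment e 0 t x +
      mehlerMoment e 0 t x)‖ ≤ C := by
  obtain ⟨C₀, h0⟩ := exists_bound_mehlerMoment e 0 0 ht
  obtain ⟨C₁, h1⟩ := exists_bound_mehlerMoment e 1 1 ht
  obtain ⟨C₂, h2⟩ := exists_bound_mehlerMoment e 2 0 ht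
  obtain ⟨C₃, h3⟩ := exists_bound_mehlerMoment e 0 2 ht
  set α := 1 / Real.sinh t ^ 2
  set β := 2 * (Real.cosh t / Real.sinh t ^ 2)
  set γ := (Real.cosh t / Real.sinh t) ^ 2
  set δ := Real.cosh t / Real.sinh t
  refine ⟨‖(1 / 2 : 𝕜)‖ * (|α| * C₂ + |β| * C₁ + (|γ| * C₃ + |δ| * C₀) + C₃ + C₀), fun x => ?_⟩
  rw [norm_mul]
  refine mul_le_mul_of_nonneg_left ?_ (norm_nonneg _)
  have k0 : ‖mehlerMoment e 0 t x‖ ≤ C₀ := by simpa using h0 x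
  have k1 : |x| * ‖mehlerMoment e 1 t x‖ ≤ C₁ := by simpa using h1 x
  have k2 : ‖mehlerMoment e 2 t x‖ ≤ C₂ := by simpa using h2 x
  have k3 : |x| ^ 2 * ‖mehlerMoment e 0 t x‖ ≤ C₃ := h3 x
  refine (norm_add_le _ _).trans (add_le_add ((norm_sub_le _ _).trans (add_le_add ?_ ?_)) k0)
  · rw [mehlerLaplacian]
    refine (norm_add_le _ _).trans (add_le_add ((norm_sub_le _ _).trans (add_le_add ?_ ?_)) ?_)
    · rw [norm_smul, Real.norm_eq_abs]
      exact mul_le_mul_of_nonneg_left k2 (abs_nonneg _)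
    · rw [norm_smul, Real.norm_eq_abs, abs_mul, mul_assoc]
      exact mul_le_mul_of_nonneg_left k1 (abs_nonneg _)
    · rw [sub_smul]
      refine (norm_sub_le _ _).trans (add_le_add ?_ ?_)
      · rw [norm_smul, Real.norm_eq_abs, abs_mul, abs_pow x, mul_assoc]
        exact mul_le_mul_of_nonneg_left k3 (abs_nonneg _)
      · rw [norm_smul, Real.norm_eq_abs]
        exact mul_le_mul_of_nonneg_left k0 (abs_nonneg _)
  · rw [norm_mul, norm_pow, RCLike.norm_ofReal]
    exact k3

theorem exists_bcf_harmonic_mehlerMoment (f : StarGraph m →ᵇ 𝕜) {t : ℝ} (ht : 0 < t) :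
    ∃ g : StarGraph m →ᵇ 𝕜, ∀ i (x : ℝ≥0), g (pt i x) =
      1 / 2 * (mehlerLaplacian (reflectExt f i) t x -
        ((x : ℝ) : 𝕜) ^ 2 * mehlerMoment (reflectExt f i) 0 t x +
          mehlerMoment (reflectExt f i) 0 t x) := by
  refine exists_bcf_of_components (fun i x => 1 / 2 * (mehlerLaplacian (reflectExt f i) t x -
        (x : 𝕜) ^ 2 * mehlerMoment (reflectExt f i) 0 t x +
          mehlerMoment (reflectExt f i) 0 t x)) (fun i => ?_) (fun i j => ?_)
    fun i => exists_bound_harmonic_mehlerMoment (reflectExt f i) ht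
  · have h1 := continuous_mehlerLaplacian (reflectExt f i) ht
    have h2 := continuous_mehlerMoment_space (reflectExt f i) 0 ht
    have h3 := RCLike.continuous_ofReal (K := 𝕜)
    fun_prop
  -- At `x = 0` the first moment carries a factor `x` and drops out; the even moments agree on all
  -- rays.
  · simp only [mehlerLaplacian, mul_zero, zero_smul,
      mehlerMoment_reflectExt_vertex f i j Even.zero ht,
      mehlerMoment_reflectExt_vertex f i j even_two ht]

theorem isWeakDeriv_mehlerSolution (f : StarGraph m →ᵇ 𝕜) {t : ℝ≥0} (ht : 0 < t) (i : Fin m) :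
    IsWeakDeriv (onRay (timeSlice (mehlerSolution f) t) i)
      (fun x => -(Real.cosh t / Real.sinh t * x) • mehlerMoment (reflectExt f i) 0 t x +
        (1 / Real.sinh t) • mehlerMoment (reflectExt f i) 1 t x) := by
  refine IsWeakDeriv.of_hasDerivAt (fun x hx => onRay_timeSlice_mehlerSolution f ht i hx)
    (fun x => hasDerivAt_mehlerMoment_space _ 0 (NNReal.coe_pos.2 ht) x) ?_
  exact continuous_iff_continuousAt.2 fun x =>
    (hasDerivAt_deriv_mehlerMoment (reflectExt f i) (NNReal.coe_pos.2 ht) x).continuousAt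

theorem isWeakDeriv_deriv_mehlerMoment (e : ℝ →ᵇ 𝕜) {t : ℝ} (ht : 0 < t) :
    IsWeakDeriv (fun x => -(Real.cosh t / Real.sinh t * x) • mehlerMoment e 0 t x +
      (1 / Real.sinh t) • mehlerMoment e 1 t x) (mehlerLaplacian e t) :=
  IsWeakDeriv.of_hasDerivAt (fun _ _ => rfl) (fun x => hasDerivAt_deriv_mehlerMoment e ht x)
    (continuous_mehlerLaplacian e ht)

theorem isHarmonicImage_mehlerSolution (f : StarGraph m →ᵇ 𝕜) {t : ℝ≥0} (ht : 0 < t)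
    {g : StarGraph m →ᵇ 𝕜} (hg : ∀ i (x : ℝ≥0), g (pt i x) =
      1 / 2 * (mehlerLaplacian (reflectExt f i) t x -
        ((x : ℝ) : 𝕜) ^ 2 * mehlerMoment (reflectExt f i) 0 t x +
          mehlerMoment (reflectExt f i) 0 t x)) :
    IsHarmonicImage (timeSlice (mehlerSolution f) t) g := by
  intro i
  refine ⟨_, _, isWeakDeriv_mehlerSolution f ht i,
    isWeakDeriv_deriv_mehlerMoment (reflectExt f i) (NNReal.coe_pos.2 ht), ?_⟩
  refine (ae_restrict_iff' measurableSet_Ioi).2 (Eventually.of_forall fun x hx => ?_)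
  have hx' : 0 ≤ x := le_of_lt hx
  rw [onRay_timeSlice_mehlerSolution f ht i hx', onRay, hg, Real.coe_toNNReal x hx']

theorem kirchhoff_mehlerSolution (f : StarGraph m →ᵇ 𝕜) {t : ℝ≥0} (ht : 0 < t) :
    Kirchhoff (timeSlice (mehlerSolution f) t : StarGraph m → 𝕜) := by
  have ht' := NNReal.coe_pos.2 ht
  refine ⟨fun i => (1 / Real.sinh t) • mehlerMoment (reflectExt f i) 1 t 0, fun i => ?_, ?_⟩
  · have h := (hasDerivAt_mehlerMoment_space (reflectExt f i) 0 ht' 0).hasDerivWithinAt (s := Ici 0)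
    rw [mul_zero, neg_zero, zero_smul, zero_add] at h
    exact h.congr (fun x hx => onRay_timeSlice_mehlerSolution f ht i hx)
      (onRay_timeSlice_mehlerSolution f ht i le_rfl)
  · simp only [mehlerMoment, zero_div]
    rw [← Finset.smul_sum, ← Finset.smul_sum, sum_gaussMoment_reflectExt_one f
      (div_pos (Real.cosh_pos _) (Real.sinh_pos_iff.2 ht')), smul_zero, smul_zero]

theorem timeSlice_mehlerSolution_mem_domain (f : StarGraph m →ᵇ 𝕜) {t : ℝ≥0} (ht : 0 < t) :
    timeSlice (mehlerSolution f) t ∈ harmonicDomain 𝕜 m := by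
  have ht' := NNReal.coe_pos.2 ht
  obtain ⟨g, hg⟩ := exists_bcf_harmonic_mehlerMoment f ht'
  refine ⟨fun p _ _ i => ?_, kirchhoff_mehlerSolution f ht,
    g, isHarmonicImage_mehlerSolution f ht hg⟩
  refine ⟨memLp_Ioo_of_eq_continuous (fun x hx => onRay_timeSlice_mehlerSolution f ht i hx)
      (continuous_mehlerMoment_space _ 0 ht') p, _, isWeakDeriv_mehlerSolution f ht i,
    memLp_Ioo_of_eq_continuous (fun _ _ => rfl) ?_ p, _,
    isWeakDeriv_deriv_mehlerMoment (reflectExt f i) ht',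
    memLp_Ioo_of_eq_continuous (fun _ _ => rfl) (continuous_mehlerLaplacian _ ht') p⟩
  exact continuous_iff_continuousAt.2 fun x =>
    (hasDerivAt_deriv_mehlerMoment (reflectExt f i) ht' x).continuousAt

theorem hasDerivAt_mehlerSolution (f : StarGraph m →ᵇ 𝕜) {t : ℝ} (ht : 0 < t) (i : Fin m)
    (x : ℝ≥0) :
    HasDerivAt (fun s : ℝ => mehlerSolution f (s.toNNReal, pt i x))
      (1 / 2 * (mehlerLaplacian (reflectExt f i) t x -
        ((x : ℝ) : 𝕜) ^ 2 * mehlerMoment (reflectExt f i) 0 t x +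
          mehlerMoment (reflectExt f i) 0 t x)) t := by
  refine (hasDerivAt_mehlerMoment_harmonic (reflectExt f i) ht x).congr_of_eventuallyEq ?_
  filter_upwards [Ioi_mem_nhds ht] with s hs
  rw [mehlerSolution_pt_of_pos f (Real.toNNReal_pos.2 hs), Real.coe_toNNReal s (le_of_lt hs)]

/-- The Mehler-type formula gives a classical solution. -/
theorem isClassicalSolution_mehlerSolution (f : StarGraph m →ᵇ 𝕜) :
    IsClassicalSolution f (mehlerSolution f) where
  contDiffOn p := by
    obtain ⟨i, x, rfl⟩ := p.exists_eq_pt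
    rw [show (1 : WithTop ℕ∞) = 0 + 1 by rfl, contDiffOn_succ_iff_deriv_of_isOpen isOpen_Ioi]
    refine ⟨fun t ht =>
      (hasDerivAt_mehlerSolution f ht i x).differentiableAt.differentiableWithinAt, by simp, ?_⟩
    rw [contDiffOn_zero]
    refine ContinuousOn.congr (fun t ht => ?_) fun t ht => (hasDerivAt_mehlerSolution f ht i x).deriv
    have h1 := continuousAt_mehlerLaplacian_time (reflectExt f i) ht x
    have h2 := continuousAt_mehlerMoment_time (reflectExt f i) 0 ht x
    exact (continuousAt_const.mul
      ((h1.sub (continuousAt_const.mul h2)).add h2)).continuousWithinAt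
  mem_domain t ht := timeSlice_mehlerSolution_mem_domain f ht
  equation t ht := by
    obtain ⟨g, hg⟩ := exists_bcf_harmonic_mehlerMoment f (NNReal.coe_pos.2 ht)
    refine ⟨g, isHarmonicImage_mehlerSolution f ht hg, fun p => ?_⟩
    obtain ⟨i, x, rfl⟩ := p.exists_eq_pt
    rw [(hasDerivAt_mehlerSolution f (NNReal.coe_pos.2 ht) i x).deriv, hg]
  initial p := by
    obtain ⟨i, x, rfl⟩ := p.exists_eq_pt
    rw [mehlerSolution_pt, NNReal.coe_zero, mehlerAverage_zero,
      reflectExt_of_nonneg f i x.coe_nonneg, onRay_coe]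

/-- The solution operators of the harmonic oscillator on the star graph. -/
noncomputable def mehlerSemigroup (𝕜 : Type*) [RCLike 𝕜] (m : ℕ) [NeZero m] (t : ℝ≥0) :
    (StarGraph m →ᵇ 𝕜) →L[𝕜] (StarGraph m →ᵇ 𝕜) :=
  LinearMap.mkContinuous
    { toFun := fun f => timeSlice (mehlerSolution f) t
      map_add' := fun f g => by
        ext p
        obtain ⟨i, x, rfl⟩ := p.exists_eq_pt
        change mehlerSolution (f + g) (t, pt i x) =
          mehlerSolution f (t, pt i x) + mehlerSolution g (t, pt i x)
        simp only [mehlerSolution_pt, reflectExt_add, mehlerAverage_add]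
      map_smul' := fun c f => by
        ext p
        obtain ⟨i, x, rfl⟩ := p.exists_eq_pt
        change mehlerSolution (c • f) (t, pt i x) = c • mehlerSolution f (t, pt i x)
        simp only [mehlerSolution_pt, reflectExt_smul, mehlerAverage_smul] }
    10 fun f => (BoundedContinuousFunction.norm_le (by positivity)).2 fun p =>
      ((mehlerSolution f).norm_coe_le_norm (t, p)).trans (norm_mehlerSolution_le f)

theorem mehlerSemigroup_apply (t : ℝ≥0) (f : StarGraph m →ᵇ 𝕜) (p : StarGraph m) :
    mehlerSemigroup 𝕜 m t f p = mehlerSolution f (t, p) := rfl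

end Solution

/-! ### Time translates of classical solutions -/

section Shift

variable {𝕜 : Type*} [RCLike 𝕜] {m : ℕ}

/-- The time translate `u(· + s, ·)`. -/
def timeShift (u : (ℝ≥0 × StarGraph m) →ᵇ 𝕜) (s : ℝ≥0) : (ℝ≥0 × StarGraph m) →ᵇ 𝕜 :=
  u.compContinuous ⟨fun p => (p.1 + s, p.2), by fun_prop⟩

theorem timeShift_eqOn (u : (ℝ≥0 × StarGraph m) →ᵇ 𝕜) (s : ℝ≥0) (p : StarGraph m) :
    EqOn (fun t : ℝ => timeShift u s (t.toNNReal, p))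
      (fun t : ℝ => u ((t + s).toNNReal, p)) (Ioi 0) := fun t ht => by
  change u (t.toNNReal + s, p) = u ((t + s).toNNReal, p)
  rw [Real.toNNReal_add (le_of_lt ht) s.coe_nonneg, Real.toNNReal_coe]

theorem IsClassicalSolution.timeShift {f : StarGraph m →ᵇ 𝕜} {u : (ℝ≥0 × StarGraph m) →ᵇ 𝕜}
    (hu : IsClassicalSolution f u) (s : ℝ≥0) :
    IsClassicalSolution (timeSlice u s) (timeShift u s) where
  contDiffOn p := by
    refine ContDiffOn.congr ?_ (timeShift_eqOn u s p)
    exact (hu.contDiffOn p).comp (contDiff_id.add contDiff_const).contDiffOn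
      fun t ht => add_pos_of_pos_of_nonneg (mem_Ioi.1 ht) s.coe_nonneg
  mem_domain t ht := hu.mem_domain (t + s) (add_pos_of_pos_of_nonneg ht zero_le)
  equation t ht := by
    obtain ⟨g, hg, hgt⟩ := hu.equation (t + s) (add_pos_of_pos_of_nonneg ht zero_le)
    refine ⟨g, hg, fun p => ?_⟩
    rw [← hgt p, Filter.EventuallyEq.deriv_eq
      ((timeShift_eqOn u s p).eventuallyEq_of_mem (Ioi_mem_nhds (NNReal.coe_pos.2 ht))),
      deriv_comp_add_const (fun t : ℝ => u (t.toNNReal, p)), NNReal.coe_add]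
  initial p := by
    change u (0 + s, p) = u (s, p)
    rw [zero_add]

end Shift

theorem corollary5p1 {𝕜 : Type*} [RCLike 𝕜] (m : ℕ) (hm : 1 ≤ m) :
    ∃ U : ℝ≥0 → (StarGraph m →ᵇ 𝕜) →L[𝕜] (StarGraph m →ᵇ 𝕜),
      U 0 = ContinuousLinearMap.id 𝕜 (StarGraph m →ᵇ 𝕜) ∧
      (∀ s t : ℝ≥0, U (s + t) = (U s).comp (U t)) ∧
      (∀ t : ℝ≥0, 0 < t → ∀ (f : StarGraph m →ᵇ 𝕜) (i : Fin m) (x : ℝ≥0),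
        U t f (StarGraph.pt i x) = mehlerStar (t : ℝ) f i (x : ℝ)) ∧
      ∀ f : StarGraph m →ᵇ 𝕜, ∃ u : (ℝ≥0 × StarGraph m) →ᵇ 𝕜,
        IsClassicalSolution f u ∧
        (∀ v : (ℝ≥0 × StarGraph m) →ᵇ 𝕜, IsClassicalSolution f v → v = u) ∧
        ∀ (t : ℝ≥0) (x : StarGraph m), u (t, x) = U t f x := by
  have : NeZero m := ⟨Nat.one_le_iff_ne_zero.1 hm⟩
  refine ⟨mehlerSemigroup 𝕜 m, ?_, fun s t => ?_, fun t ht f i x => ?_, fun f =>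
    ⟨mehlerSolution f, isClassicalSolution_mehlerSolution f,
      fun v hv => hv.unique (isClassicalSolution_mehlerSolution f), fun t x => rfl⟩⟩
  · ext f p
    exact (isClassicalSolution_mehlerSolution f).initial p
  · ext f p
    -- The translated solution and the solution restarted from its value at time `t` solve the same
    -- Cauchy problem.
    have h := ((isClassicalSolution_mehlerSolution f).timeShift t).unique
      (isClassicalSolution_mehlerSolution (timeSlice (mehlerSolution f) t))
    exact DFunLike.congr_fun h (s, p)
  · rw [mehlerSemigroup_apply, mehlerSolution_pt_of_pos f ht,
      mehlerMoment_reflectExt_eq_mehlerStar f i (NNReal.coe_pos.2 ht)]
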